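/- Let $n\ge 3$. Write $\mathrm{Spin}(n,1)$ for the connected spin group of $\mathbb R^{n+1}$ with the quadratic form $-v_0^2+v_1^2+\dots+v_n^2$, with covering map $\ell\colon \mathrm{Spin}(n,1)\to \mathrm{SO}(n,1)$, $\ell(S)v=SvS^{-1}$, and regard $\mathrm{Spin}(n)$ as a closed subgroup of $\mathrm{Spin}(n,1)$ through the inclusion $\mathbb R^n\hookrightarrow\mathbb R^{n+1}$, $w\mapsto(0,w)$. Let $M$ be a Lorentzian spin manifold of dimension $n+1$, i.e. a smooth (Hausdorff, second countable) orientable manifold which admits a smooth metric $g$ of signature $(n,1)$ and a spin structure: a principal $\mathrm{Spin}(n,1)$-bundle together with a smooth $\ell$-equivariant map, over the identity of $M$, into the bundle of positively oriented $g$-orthonormal frames. Let $p\colon P\to M$ be any smooth principal $\mathrm{Spin}(n,1)$-bundle (not necessarily that of a spin structure). Then $P$ admits a $\mathrm{Spin}(n)$-reduction: there are a smooth principal $\mathrm{Spin}(n)$-bundle $q\colon Q\to M$ and a smooth $\mathrm{Spin}(n)$-equivariant embedding $Q\hookrightarrow P$ over the identity of $M$. Equivalently, the associated coset bundle $P\times_{\mathrm{Spin}(n,1)}\bigl(\mathrm{Spin}(n,1)/\mathrm{Spin}(n)\bigr)\to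 M$ has a smooth global section. -/

import Mathlib

open scoped Manifold ContDiff Topology RightActions

universe u v

noncomputable section

/-! ### Spin groups -/

section Spin

variable {V W : Type*} [AddCommGroup V] [Module ℝ V] [AddCommGroup W] [Module ℝ W]

/-- A real Clifford algebra carries its canonical topology as a real vector space (for a
finite-dimensional algebra this is the usual one); `spinGroup Q` gets the subspace topology. -/
instance cliffordTopology (Q : QuadraticForm ℝ V) : TopologicalSpace (CliffordAlgebra Q) :=
  moduleTopology ℝ (CliffordAlgebra Q)

/-- The homomorphism of spin groups induced, by functoriality of Clifford algebras, by a linear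
isometry of the underlying quadratic spaces. -/
def spinMap {Q₁ : QuadraticForm ℝ W} {Q₂ : QuadraticForm ℝ V} (f : Q₁ →qᵢ Q₂) :
    spinGroup Q₁ →* spinGroup Q₂ where
  toFun x := ⟨CliffordAlgebra.map f x, by
    have hstar : ∀ y : CliffordAlgebra Q₁,
        CliffordAlgebra.map f (star y) = star (CliffordAlgebra.map f y) := by
      intro y
      induction y using CliffordAlgebra.induction with
      | algebraMap r => simp only [CliffordAlgebra.star_algebraMap, AlgHom.commutes]
      | ι v => simp [CliffordAlgebra.star_ι, CliffordAlgebra.map_apply_ι]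
      | mul a b ha hb => simp only [star_mul, map_mul, ha, hb]
      | add a b ha hb => simp only [star_add, map_add, ha, hb]
    have hlip : ∀ u ∈ lipschitzGroup Q₁,
        Units.map (CliffordAlgebra.map f : CliffordAlgebra Q₁ →* CliffordAlgebra Q₂) u
          ∈ lipschitzGroup Q₂ := by
      intro u hu
      unfold lipschitzGroup at hu
      induction hu using Subgroup.closure_induction with
      | mem u hu =>
        obtain ⟨a, ha⟩ := hu
        refine Subgroup.subset_closure ⟨f a, ?_⟩
        rw [← CliffordAlgebra.map_apply_ι, ha]
        rfl
      | one => simp only [map_one, one_mem]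
      | mul u v _ _ hu hv => rw [map_mul]; exact mul_mem hu hv
      | inv u _ hu => rw [map_inv]; exact inv_mem hu
    have heven : ∀ y ∈ CliffordAlgebra.even Q₁,
        CliffordAlgebra.map f y ∈ CliffordAlgebra.even Q₂ := by
      intro y hy
      induction y, hy using CliffordAlgebra.even_induction with
      | algebraMap r => rw [AlgHom.commutes]; exact Subalgebra.algebraMap_mem _ r
      | add a b _ _ ha hb => rw [map_add]; exact add_mem ha hb
      | ι_mul_ι_mul a b c _ hc =>
        rw [map_mul, map_mul, CliffordAlgebra.map_apply_ι, CliffordAlgebra.map_apply_ι]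
        exact mul_mem (CliffordAlgebra.ι_mul_ι_mem_evenOdd_zero _ _ _) hc
    obtain ⟨x, ⟨⟨u, hu, rfl⟩, h₁, h₂⟩, h₃⟩ := x
    refine ⟨⟨⟨_, hlip u hu, rfl⟩, ?_, ?_⟩, heven _ h₃⟩
    · rw [← hstar, ← map_mul, h₁, map_one]
    · rw [← hstar, ← map_mul, h₂, map_one]⟩
  map_one' := Subtype.ext (map_one _)
  map_mul' x y := Subtype.ext (map_mul _ _ _)

/-- The covering map `ℓ` of the spin group: `ℓ(S)` is the linear map of `V` such that
`ι (ℓ(S) v) = S * ι v * S⁻¹` (see `ι_vectorRep`). -/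
def vectorRep (Q : QuadraticForm ℝ V) (S : spinGroup Q) : V →ₗ[ℝ] V :=
  letI : Invertible (2 : ℝ) := invertibleOfNonzero two_ne_zero
  ExteriorAlgebra.ιInv ∘ₗ (CliffordAlgebra.equivExterior Q).toLinearMap ∘ₗ
    LinearMap.mulRight ℝ ((S⁻¹ : spinGroup Q) : CliffordAlgebra Q) ∘ₗ
      LinearMap.mulLeft ℝ (S : CliffordAlgebra Q) ∘ₗ CliffordAlgebra.ι Q

theorem ι_vectorRep (Q : QuadraticForm ℝ V) (S : spinGroup Q) (v : V) :
    CliffordAlgebra.ι Q (vectorRep Q S v) =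
      (S : CliffordAlgebra Q) * CliffordAlgebra.ι Q v * ((S⁻¹ : spinGroup Q) : CliffordAlgebra Q) := by
  let : Invertible (2 : ℝ) := invertibleOfNonzero two_ne_zero
  obtain ⟨w, hw⟩ := spinGroup.conjAct_smul_ι_mem_range_ι (x := spinGroup.toUnits S) S.2 v
  have hw' : CliffordAlgebra.ι Q w =
      (S : CliffordAlgebra Q) * CliffordAlgebra.ι Q v *
        ((S⁻¹ : spinGroup Q) : CliffordAlgebra Q) := by
    rw [hw, ConjAct.units_smul_def]; rfl
  have h : vectorRep Q S v = w := by
    simp only [vectorRep, LinearMap.comp_apply, LinearMap.mulLeft_apply, LinearMap.mulRight_apply,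
      ← hw']
    have : (CliffordAlgebra.equivExterior Q) (CliffordAlgebra.ι Q w) = ExteriorAlgebra.ι ℝ w :=
      CliffordAlgebra.changeForm_ι CliffordAlgebra.changeForm.associated_neg_proof w
    rw [LinearEquiv.coe_coe, this]
    exact ExteriorAlgebra.ι_leftInverse w
  rw [h, hw']

end Spin

/-- The Minkowski quadratic form `-v₀² + v₁² + ⋯ + vₙ²`, of signature `(n,1)`. -/
def minkowskiForm (n : ℕ) : QuadraticForm ℝ (Fin (n + 1) → ℝ) :=
  QuadraticMap.weightedSumSquares ℝ (Fin.cons (-1) (fun _ => 1) : Fin (n + 1) → ℝ)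

/-- The Euclidean quadratic form `w₁² + ⋯ + wₙ²`. -/
def euclideanForm (n : ℕ) : QuadraticForm ℝ (Fin n → ℝ) :=
  QuadraticMap.weightedSumSquares ℝ (fun _ => 1 : Fin n → ℝ)

/-- The isometric embedding `(w₁, …, wₙ) ↦ (0, w₁, …, wₙ)`. -/
def spatialInclusion (n : ℕ) : euclideanForm n →qᵢ minkowskiForm n where
  toFun w := Fin.cons 0 w
  map_add' v w := by
    ext i; refine Fin.cases ?_ (fun j => ?_) i <;> simp
  map_smul' c w := by
    ext i; refine Fin.cases ?_ (fun j => ?_) i <;> simp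
  map_app' w := by
    simp [minkowskiForm, euclideanForm, QuadraticMap.weightedSumSquares_apply, Fin.sum_univ_succ]

/-- `Spin(n,1)`. An element of `spinGroup` is an even product of non-null vectors with
`S * reverse S = 1`; in signature `(n,1)` it is a product with an even number of timelike and an
even number of spacelike factors, so for `n ≥ 2` this is the connected group, the double cover of
the identity component of `SO(n,1)`. -/
abbrev LorentzSpin (n : ℕ) := spinGroup (minkowskiForm n)

/-- `Spin(n)`. -/
abbrev EuclideanSpin (n : ℕ) := spinGroup (euclideanForm n)

/-- The standard embedding `Spin(n) ↪ Spin(n,1)`. -/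
def spinInclusion (n : ℕ) : EuclideanSpin n →* LorentzSpin n := spinMap (spatialInclusion n)

/-! ### Smooth principal bundles with a spin group as structure group -/

section Bundles

variable {V : Type*} [AddCommGroup V] [Module ℝ V]

/-- Smoothness on a set of a map from a manifold to a spin group, the latter being an embedded
submanifold of the (finite-dimensional) Clifford algebra: the map is smooth as a map to the
Clifford algebra, i.e. all its compositions with linear functionals are smooth. -/
def SpinSmoothOn {m : ℕ} {M : Type*} [TopologicalSpace M]
    [ChartedSpace (EuclideanSpace ℝ (Fin m)) M] {Q : QuadraticForm ℝ V}
    (f : M → spinGroup Q) (U : Set M) : Prop :=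
  ∀ φ : Module.Dual ℝ (CliffordAlgebra Q),
    ContMDiffOn (𝓡 m) 𝓘(ℝ, ℝ) ∞ (fun x => φ (f x : CliffordAlgebra Q)) U

/-- A smooth principal bundle with structure group `spinGroup Q` over the manifold `M`: a space
with a right action of the group, and an atlas of equivariant local trivializations over open
sets `U`, `proj ⁻¹' U ≃ U × spinGroup Q`, whose transition functions are smooth. -/
structure PrincipalSpinBundle (Q : QuadraticForm ℝ V) (m : ℕ) (M : Type u) [TopologicalSpace M]
    [ChartedSpace (EuclideanSpace ℝ (Fin m)) M] where
  carrier : Type v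
  [top : TopologicalSpace carrier]
  [act : MulAction (spinGroup Q)ᵐᵒᵖ carrier]
  proj : carrier → M
  atlas : Set (Bundle.Trivialization (spinGroup Q) proj)
  exists_mem_baseSet : ∀ x, ∃ e ∈ atlas, x ∈ e.baseSet
  proj_act : ∀ p (S : spinGroup Q), proj (p <• S) = proj p
  triv_act : ∀ e ∈ atlas, ∀ p, proj p ∈ e.baseSet → ∀ S : spinGroup Q,
    (e (p <• S)).2 = (e p).2 * S
  smooth_transition : ∀ e ∈ atlas, ∀ e' ∈ atlas,
    SpinSmoothOn (m := m) (fun x => (e' (e.toOpenPartialHomeomorph.symm (x, 1))).2)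
      (e.baseSet ∩ e'.baseSet)

attribute [instance] PrincipalSpinBundle.top PrincipalSpinBundle.act

variable {W : Type*} [AddCommGroup W] [Module ℝ W]
  {m : ℕ} {M : Type u} [TopologicalSpace M] [ChartedSpace (EuclideanSpace ℝ (Fin m)) M]

/-- `σ` restricts to a smooth local section over `U` of the principal bundle. -/
def PrincipalSpinBundle.IsSmoothSectionOn {Q : QuadraticForm ℝ V}
    (P : PrincipalSpinBundle.{u, v} Q m M) (σ : M → P.carrier) (U : Set M) : Prop :=
  (∀ x ∈ U, P.proj (σ x) = x) ∧
    ∀ e ∈ P.atlas, SpinSmoothOn (m := m) (fun x => (e (σ x)).2) (U ∩ e.baseSet)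

/-- A reduction of the principal bundle `P` along the embedding `θ` of spin groups: a smooth
principal bundle with the smaller structure group and a smooth `θ`-equivariant embedding into `P`
which covers the identity of `M`. In local trivializations the embedding has the form
`(x, S) ↦ (x, a(x) * θ S)`, so that it is smooth exactly when the maps `a` are. -/
structure PrincipalSpinBundle.Reduction {Q₁ : QuadraticForm ℝ W} {Q₂ : QuadraticForm ℝ V}
    (θ : spinGroup Q₁ →* spinGroup Q₂) (P : PrincipalSpinBundle.{u, v} Q₂ m M) where
  bundle : PrincipalSpinBundle.{u, v} Q₁ m M
  toFun : bundle.carrier → P.carrier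
  proj_toFun : ∀ q, P.proj (toFun q) = bundle.proj q
  map_act : ∀ q (S : spinGroup Q₁), toFun (q <• S) = toFun q <• θ S
  smooth : ∀ e ∈ bundle.atlas, ∀ e' ∈ P.atlas,
    SpinSmoothOn (m := m) (fun x => (e' (toFun (e.toOpenPartialHomeomorph.symm (x, 1)))).2)
      (e.baseSet ∩ e'.baseSet)
  isEmbedding : Topology.IsEmbedding toFun

/-- The relation `(p, c) ∼ (p · S, S⁻¹ c)` on `P × G/H`, where `G` is the structure group. -/
def PrincipalSpinBundle.cosetSetoid {Q : QuadraticForm ℝ V}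
    (P : PrincipalSpinBundle.{u, v} Q m M) (H : Subgroup (spinGroup Q)) :
    Setoid (P.carrier × (spinGroup Q ⧸ H)) where
  r a b := ∃ S : spinGroup Q, b = (a.1 <• S, S⁻¹ • a.2)
  iseqv :=
    { refl := fun a => ⟨1, by simp⟩
      symm := by
        rintro a _ ⟨S, rfl⟩
        refine ⟨S⁻¹, ?_⟩
        simp [smul_smul]
      trans := by
        rintro a _ _ ⟨S, rfl⟩ ⟨T, rfl⟩
        refine ⟨S * T, ?_⟩
        simp [smul_smul, ← MulOpposite.op_mul] }

/-- The total space `P ×_G (G/H)` of the `H`-coset bundle of `P`. -/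
def PrincipalSpinBundle.CosetBundle {Q : QuadraticForm ℝ V}
    (P : PrincipalSpinBundle.{u, v} Q m M) (H : Subgroup (spinGroup Q)) : Type _ :=
  Quotient (P.cosetSetoid H)

/-- The projection of the coset bundle onto `M`. -/
def PrincipalSpinBundle.cosetProj {Q : QuadraticForm ℝ V}
    (P : PrincipalSpinBundle.{u, v} Q m M) (H : Subgroup (spinGroup Q)) :
    P.CosetBundle H → M :=
  Quotient.lift (fun a => P.proj a.1) (by rintro a _ ⟨S, rfl⟩; exact (P.proj_act a.1 S).symm)

/-- `s` is a smooth global section of the `H`-coset bundle. As `G → G/H` is a smooth submersion,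
smoothness of `s` means that locally `s(x) = [σ(x), a(x)H]` with a smooth local section `σ` of
`P` and a smooth `G`-valued function `a`. -/
def PrincipalSpinBundle.IsSmoothCosetSection {Q : QuadraticForm ℝ V}
    (P : PrincipalSpinBundle.{u, v} Q m M) (H : Subgroup (spinGroup Q))
    (s : M → P.CosetBundle H) : Prop :=
  (∀ x, P.cosetProj H (s x) = x) ∧
    ∀ x₀, ∃ U ∈ 𝓝 x₀, ∃ (σ : M → P.carrier) (a : M → spinGroup Q),
      P.IsSmoothSectionOn σ U ∧ SpinSmoothOn (m := m) a U ∧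
        ∀ x ∈ U, s x = Quotient.mk (P.cosetSetoid H) (σ x, (a x : spinGroup Q ⧸ H))

end Bundles

/-! ### Lorentzian spin manifolds -/

section SpinManifold

/-- `o` is an orientation of the manifold `M`: an orientation of every tangent space, given
locally by smooth frames. -/
def IsManifoldOrientation {m : ℕ} {M : Type*} [TopologicalSpace M]
    [ChartedSpace (EuclideanSpace ℝ (Fin m)) M] [IsManifold (𝓡 m) ∞ M]
    (o : ∀ x : M, Orientation ℝ (TangentSpace (𝓡 m) x) (Fin m)) : Prop :=
  ∀ x₀ : M, ∃ U ∈ 𝓝 x₀, ∃ X : Fin m → ∀ x : M, TangentSpace (𝓡 m) x,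
    (∀ i, ContMDiffOn (𝓡 m) (𝓡 m).tangent ∞
      (fun x => (⟨x, X i x⟩ : TangentBundle (𝓡 m) M)) U) ∧
    ∀ x ∈ U, ∃ b : Module.Basis (Fin m) ℝ (TangentSpace (𝓡 m) x),
      (∀ i, b i = X i x) ∧ b.orientation = o x

/-- A smooth metric of signature `(n,1)` on an `(n+1)`-dimensional manifold. -/
structure LorentzMetric (n : ℕ) (M : Type*) [TopologicalSpace M]
    [ChartedSpace (EuclideanSpace ℝ (Fin (n + 1))) M] [IsManifold (𝓡 (n + 1)) ∞ M] where
  val (x : M) : TangentSpace (𝓡 (n + 1)) x →L[ℝ] TangentSpace (𝓡 (n + 1)) x →L[ℝ] ℝ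
  signature (x : M) : ∃ E : (Fin (n + 1) → ℝ) ≃ₗ[ℝ] TangentSpace (𝓡 (n + 1)) x,
    ∀ v w, val x (E v) (E w) = QuadraticMap.associated (minkowskiForm n) v w
  contMDiff : ContMDiff (𝓡 (n + 1)) ((𝓡 (n + 1)).prod
      𝓘(ℝ, EuclideanSpace ℝ (Fin (n + 1)) →L[ℝ] EuclideanSpace ℝ (Fin (n + 1)) →L[ℝ] ℝ)) ∞
    (fun x => Bundle.TotalSpace.mk'
      (EuclideanSpace ℝ (Fin (n + 1)) →L[ℝ] EuclideanSpace ℝ (Fin (n + 1)) →L[ℝ] ℝ) x (val x))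

/-- A spin structure on `M` with metric `g` and orientation `o`: a principal `Spin(n,1)`-bundle
with a smooth map to the bundle of positive `g`-orthonormal frames `ℝⁿ⁺¹ ≃ TₓM`, which covers the
identity of `M` and is equivariant along `ℓ`. -/
structure LorentzSpinStructure (n : ℕ) (M : Type u) [TopologicalSpace M]
    [ChartedSpace (EuclideanSpace ℝ (Fin (n + 1))) M] [IsManifold (𝓡 (n + 1)) ∞ M]
    (g : LorentzMetric n M)
    (o : ∀ x : M, Orientation ℝ (TangentSpace (𝓡 (n + 1)) x) (Fin (n + 1))) where
  bundle : PrincipalSpinBundle.{u, u} (minkowskiForm n) (n + 1) M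
  frame (p : bundle.carrier) : (Fin (n + 1) → ℝ) ≃ₗ[ℝ] TangentSpace (𝓡 (n + 1)) (bundle.proj p)
  orthonormal : ∀ p v w,
    g.val (bundle.proj p) (frame p v) (frame p w) = QuadraticMap.associated (minkowskiForm n) v w
  positive : ∀ p, ((Pi.basisFun ℝ (Fin (n + 1))).map (frame p)).orientation = o (bundle.proj p)
  equivariant : ∀ p (S : LorentzSpin n) v,
    (⟨bundle.proj (p <• S), frame (p <• S) v⟩ : TangentBundle (𝓡 (n + 1)) M) =
      ⟨bundle.proj p, frame p (vectorRep (minkowskiForm n) S v)⟩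
  smooth : ∀ e ∈ bundle.atlas, ∀ v, ContMDiffOn (𝓡 (n + 1)) (𝓡 (n + 1)).tangent ∞
    (fun x => (⟨_, frame (e.toOpenPartialHomeomorph.symm (x, 1)) v⟩ :
      TangentBundle (𝓡 (n + 1)) M)) e.baseSet

/-- `M` is a Lorentzian spin manifold: it is orientable, and it admits a metric of signature
`(n,1)` and a spin structure. -/
def IsLorentzSpinManifold (n : ℕ) (M : Type u) [TopologicalSpace M]
    [ChartedSpace (EuclideanSpace ℝ (Fin (n + 1))) M] [IsManifold (𝓡 (n + 1)) ∞ M] : Prop :=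
  ∃ o : ∀ x : M, Orientation ℝ (TangentSpace (𝓡 (n + 1)) x) (Fin (n + 1)),
    IsManifoldOrientation o ∧ ∃ g : LorentzMetric n M, Nonempty (LorentzSpinStructure n M g o)

end SpinManifold

end

/-!
A reduction of `P` to `Spin(n)`, or a section of the coset bundle, is a choice of future unit vector
in the Minkowski bundle associated with `P`: `Spin(n,1)` acts transitively on the hyperboloid of
future unit vectors, with stabilizer `Spin(n)` at the time axis. Such a choice always exists, because
the future timelike vectors form a convex cone that `Spin(n,1)` preserves: local choices can be
averaged by a smooth partition of unity and then normalized (`nonempty_unitTimeField`).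

The algebra behind this takes place in the Clifford algebra. The future is preserved because the
generators of the Lipschitz group, which act by reflections up to sign, preserve or reverse it
according to the sign of their spinor norm (`exists_hasTimeSign`). Transitivity is witnessed by the
explicit boosts `boost u`, which depend smoothly on `u`, so no slice theorem or quotient manifold is
needed. For the stabilizer (`mem_range_spinInclusion`), an element that fixes the time axis acts on
space by an isometry, by Cartan-Dieudonné a product of reflections; it agrees up to a scalar with the
product of the corresponding vectors, as an element of the Clifford algebra on which all contractions
vanish is a scalar (`mem_range_algebraMap_of_contractLeft_eq_zero`).

The section is encoded as an equivariant function `f` on the total space of `P` (`UnitTimeField`).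
The reduced bundle is the set of points of `P` where `f` is the time axis; boosting the local sections
of `P` along `f` moves them into this set, and so trivializes it.
-/

noncomputable section

/-! ### Clifford algebras over the reals -/

section Clifford

open CliffordAlgebra

variable {V : Type*} [AddCommGroup V] [Module ℝ V] {Q : QuadraticForm ℝ V}

instance cliffordAlgebra_finite [Module.Finite ℝ V] : Module.Finite ℝ (CliffordAlgebra Q) := by
  let : Invertible (2 : ℝ) := invertibleOfNonzero two_ne_zero
  let := (Module.finBasis ℝ V).ExteriorAlgebra
  have : Module.Finite ℝ (ExteriorAlgebra ℝ V) := Module.Finite.of_basis this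
  exact Module.Finite.equiv (equivExterior Q).symm

/-- The inverse on vectors of `ι`, by which `vectorRep` is defined. -/
def cliffordToVector (Q : QuadraticForm ℝ V) : CliffordAlgebra Q →ₗ[ℝ] V :=
  letI : Invertible (2 : ℝ) := invertibleOfNonzero two_ne_zero
  ExteriorAlgebra.ιInv ∘ₗ (equivExterior Q).toLinearMap

theorem cliffordToVector_ι (w : V) : cliffordToVector Q (ι Q w) = w := by
  let : Invertible (2 : ℝ) := invertibleOfNonzero two_ne_zero
  have : (equivExterior Q) (ι Q w) = ExteriorAlgebra.ι ℝ w :=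
    changeForm_ι changeForm.associated_neg_proof w
  simp only [cliffordToVector, LinearMap.comp_apply, LinearEquiv.coe_coe, this]
  exact ExteriorAlgebra.ι_leftInverse w

theorem cliffordAlgebra_ι_injective : Function.Injective (ι Q) :=
  Function.LeftInverse.injective (g := cliffordToVector Q) cliffordToVector_ι

instance cliffordAlgebra_nontrivial : Nontrivial (CliffordAlgebra Q) :=
  letI : Invertible (2 : ℝ) := invertibleOfNonzero two_ne_zero
  inferInstance

theorem cliffordAlgebra_algebraMap_injective :
    Function.Injective (algebraMap ℝ (CliffordAlgebra Q)) :=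
  (algebraMap ℝ (CliffordAlgebra Q)).injective

/-- Twisted commutators with a vector are contractions. -/
theorem ι_mul_sub_involute_mul_ι (w : V) (b : CliffordAlgebra Q) :
    ι Q w * b - involute b * ι Q w = contractLeft (QuadraticMap.polarBilin Q w) b := by
  induction b using CliffordAlgebra.left_induction with
  | algebraMap r => simp [Algebra.commutes]
  | add x y hx hy => rw [map_add, map_add, ← hx, ← hy]; noncomm_ring
  | ι_mul x a hx =>
    rw [contractLeft_ι_mul, ← hx, map_mul, involute_ι, QuadraticMap.polarBilin_apply_apply,
      Algebra.smul_def, ← ι_mul_ι_add_swap]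
    noncomm_ring

/-- The Euler operator `x ↦ ∑ i, eᵢ ∧ (eⁱ ⌋ x)` of an exterior algebra is multiplication by the
degree. -/
theorem exteriorAlgebra_sum_ι_mul_contractLeft {I : Type*} [Fintype I] (b : Module.Basis I ℝ V)
    {k : ℕ} {x : ExteriorAlgebra ℝ V} (hx : x ∈ ⋀[ℝ]^k V) :
    ∑ i, ExteriorAlgebra.ι ℝ (b i) * contractLeft (Q := (0 : QuadraticForm ℝ V)) (b.coord i) x =
      (k : ℝ) • x := by
  induction hx using Submodule.pow_induction_on_left' with
  | algebraMap r =>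
    simp only [Nat.cast_zero, zero_smul]
    refine Finset.sum_eq_zero fun i _ => ?_
    erw [contractLeft_algebraMap, mul_zero]
  | add x y i hx hy h h' => simp only [map_add, mul_add, Finset.sum_add_distrib, h, h', smul_add]
  | mem_mul m hm i x hx h =>
    obtain ⟨a, rfl⟩ := hm
    have h1 : ∀ j, contractLeft (Q := (0 : QuadraticForm ℝ V)) (b.coord j)
        (ExteriorAlgebra.ι ℝ a * x) = b.coord j a • x - ExteriorAlgebra.ι ℝ a *
          contractLeft (Q := (0 : QuadraticForm ℝ V)) (b.coord j) x :=
      fun j => contractLeft_ι_mul _ _ _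
    have h2 : ∀ j, ExteriorAlgebra.ι ℝ (b j) * ExteriorAlgebra.ι ℝ a =
        -(ExteriorAlgebra.ι ℝ a * ExteriorAlgebra.ι ℝ (b j)) := fun j =>
      eq_neg_of_add_eq_zero_left (ExteriorAlgebra.ι_add_mul_swap _ _)
    have h3 : ∑ j, b.coord j a • ExteriorAlgebra.ι ℝ (b j) = ExteriorAlgebra.ι ℝ a := by
      simp only [← map_smul, ← map_sum, Module.Basis.coord_apply, b.sum_repr]
    simp only [h1, mul_sub, ← mul_assoc, h2, mul_smul_comm, neg_mul, sub_neg_eq_add]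
    simp only [← smul_mul_assoc, Finset.sum_add_distrib, ← Finset.sum_mul, h3]
    simp only [mul_assoc, ← Finset.mul_sum, h]
    rw [mul_smul_comm, smul_mul_assoc, Nat.cast_succ, add_smul, one_smul, add_comm]

/-- An element of a finite-dimensional Clifford algebra that all contractions kill is a scalar:
in the exterior algebra the Euler operator kills it. -/
theorem mem_range_algebraMap_of_contractLeft_eq_zero [Module.Finite ℝ V] {b : CliffordAlgebra Q}
    (hb : ∀ d : Module.Dual ℝ V, contractLeft d b = 0) : ∃ c : ℝ, algebraMap ℝ _ c = b := by
  let : Invertible (2 : ℝ) := invertibleOfNonzero two_ne_zero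
  set x : ExteriorAlgebra ℝ V := equivExterior Q b with hxdef
  have hx : ∀ d : Module.Dual ℝ V, contractLeft (Q := (0 : QuadraticForm ℝ V)) d x = 0 := by
    intro d
    have := changeForm_contractLeft (changeForm.associated_neg_proof (Q := Q)) d b
    rw [hb, map_zero] at this
    exact this.symm
  let e := Module.finBasis ℝ V
  let D : ExteriorAlgebra ℝ V →ₗ[ℝ] ExteriorAlgebra ℝ V :=
    ∑ i, LinearMap.mulLeft ℝ (ExteriorAlgebra.ι ℝ (e i)) ∘ₗ
      contractLeft (Q := (0 : QuadraticForm ℝ V)) (e.coord i)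
  have hD : ∀ y, D y = ∑ i, ExteriorAlgebra.ι ℝ (e i) *
      contractLeft (Q := (0 : QuadraticForm ℝ V)) (e.coord i) y := by
    intro y
    simp only [D, LinearMap.sum_apply, LinearMap.comp_apply, LinearMap.mulLeft_apply]
  have hDx : D x = 0 := by rw [hD]; simp only [hx, mul_zero, Finset.sum_const_zero]
  let 𝒜 : ℕ → Submodule ℝ (ExteriorAlgebra ℝ V) := fun i => ⋀[ℝ]^i V
  have key : ∀ k y, ((DirectSum.decompose 𝒜 (D y) k : 𝒜 k) : ExteriorAlgebra ℝ V) =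
      (k : ℝ) • (DirectSum.decompose 𝒜 y k : ExteriorAlgebra ℝ V) := by
    intro k y
    induction y using DirectSum.Decomposition.inductionOn 𝒜 with
    | zero => simp
    | @homogeneous i m =>
      have : D m = (i : ℝ) • (m : ExteriorAlgebra ℝ V) := by
        rw [hD]; exact exteriorAlgebra_sum_ι_mul_contractLeft e m.2
      rw [this, DirectSum.decompose_smul, DirectSum.smul_apply, Submodule.coe_smul]
      by_cases hik : i = k
      · subst hik; rfl
      · rw [DirectSum.decompose_of_mem_ne 𝒜 m.2 hik, smul_zero, smul_zero]
    | add y z hy hz =>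
      simp only [map_add, DirectSum.decompose_add, DirectSum.add_apply, Submodule.coe_add, hy, hz,
        smul_add]
  have hzero : ∀ k, k ≠ 0 → (DirectSum.decompose 𝒜 x k : ExteriorAlgebra ℝ V) = 0 := by
    intro k hk
    have := key k x
    rw [hDx, DirectSum.decompose_zero, DirectSum.zero_apply, Submodule.coe_zero] at this
    exact (smul_eq_zero.1 this.symm).resolve_left (Nat.cast_ne_zero.2 hk)
  classical
  have hx0 : x = (DirectSum.decompose 𝒜 x 0 : ExteriorAlgebra ℝ V) := by
    conv_lhs => rw [← DirectSum.sum_support_decompose 𝒜 x]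
    rw [Finset.sum_eq_single 0 (fun k _ hk => hzero k hk)]
    intro h
    simpa using h
  have hmem : x ∈ (1 : Submodule ℝ (ExteriorAlgebra ℝ V)) := by
    rw [hx0, ← pow_zero (LinearMap.range (ExteriorAlgebra.ι ℝ : V →ₗ[ℝ] ExteriorAlgebra ℝ V))]
    exact (DirectSum.decompose 𝒜 x 0).2
  obtain ⟨c, hc⟩ := Submodule.mem_one.1 hmem
  refine ⟨c, (equivExterior Q).injective ?_⟩
  rw [← hxdef, ← hc]
  exact changeForm_algebraMap changeForm.associated_neg_proof c

/-- The twisted centre of the Clifford algebra of a nondegenerate form consists of the scalars. -/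
theorem mem_range_algebraMap_of_involute_mul_ι [Module.Finite ℝ V]
    (hQ : (QuadraticMap.polarBilin Q).Nondegenerate) {b : CliffordAlgebra Q}
    (hb : ∀ w, involute b * ι Q w = ι Q w * b) : ∃ c : ℝ, algebraMap ℝ _ c = b := by
  refine mem_range_algebraMap_of_contractLeft_eq_zero fun d => ?_
  obtain ⟨w, rfl⟩ := (LinearMap.BilinForm.toDual (QuadraticMap.polarBilin Q) hQ).surjective d
  have := ι_mul_sub_involute_mul_ι w b
  rw [hb, sub_self] at this
  exact this.symm

end Clifford

/-! ### The spin groups of Minkowski and Euclidean space -/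

section SpinGroups

open CliffordAlgebra

section General

variable {V : Type*} [AddCommGroup V] [Module ℝ V] {Q : QuadraticForm ℝ V}

theorem vectorRep_eq_iff {S : spinGroup Q} {v w : V} :
    vectorRep Q S v = w ↔ (S : CliffordAlgebra Q) * ι Q v = ι Q w * (S : CliffordAlgebra Q) := by
  have hS : ((S⁻¹ : spinGroup Q) : CliffordAlgebra Q) * S = 1 := spinGroup.coe_star_mul_self S
  have hS' : (S : CliffordAlgebra Q) * ((S⁻¹ : spinGroup Q) : CliffordAlgebra Q) = 1 :=
    spinGroup.coe_mul_star_self S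
  rw [← cliffordAlgebra_ι_injective.eq_iff (a := vectorRep Q S v), ι_vectorRep]
  constructor
  · intro h
    rw [← h, mul_assoc, hS, mul_one]
  · intro h
    rw [h, mul_assoc, hS', mul_one]

theorem spin_mul_ι (S : spinGroup Q) (v : V) :
    (S : CliffordAlgebra Q) * ι Q v = ι Q (vectorRep Q S v) * (S : CliffordAlgebra Q) :=
  vectorRep_eq_iff.1 rfl

theorem vectorRep_one (v : V) : vectorRep Q 1 v = v :=
  vectorRep_eq_iff.2 (by simp)

theorem vectorRep_mul (S T : spinGroup Q) (v : V) :
    vectorRep Q (S * T) v = vectorRep Q S (vectorRep Q T v) := by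
  rw [vectorRep_eq_iff, Submonoid.coe_mul, mul_assoc, spin_mul_ι, ← mul_assoc, spin_mul_ι,
    mul_assoc]

theorem vectorRep_inv_apply_eq_iff {S : spinGroup Q} {v w : V} :
    vectorRep Q S⁻¹ v = w ↔ vectorRep Q S w = v := by
  constructor
  · rintro rfl
    rw [← vectorRep_mul, mul_inv_cancel, vectorRep_one]
  · rintro rfl
    rw [← vectorRep_mul, inv_mul_cancel, vectorRep_one]

theorem vectorRep_preserves_form (S : spinGroup Q) (v : V) : Q (vectorRep Q S v) = Q v := by
  apply cliffordAlgebra_algebraMap_injective (Q := Q)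
  have hS : ((S⁻¹ : spinGroup Q) : CliffordAlgebra Q) * S = 1 := spinGroup.coe_star_mul_self S
  have hS' : (S : CliffordAlgebra Q) * ((S⁻¹ : spinGroup Q) : CliffordAlgebra Q) = 1 :=
    spinGroup.coe_mul_star_self S
  rw [← ι_sq_scalar, ι_vectorRep]
  calc _ = (S : CliffordAlgebra Q) * ι Q v * (((S⁻¹ : spinGroup Q) : CliffordAlgebra Q) * S) *
        ι Q v * ((S⁻¹ : spinGroup Q) : CliffordAlgebra Q) := by simp only [mul_assoc]
    _ = S * (ι Q v * ι Q v) * ((S⁻¹ : spinGroup Q) : CliffordAlgebra Q) := by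
      rw [hS, mul_one]; simp only [mul_assoc]
    _ = _ := by rw [ι_sq_scalar, ← Algebra.commutes, mul_assoc, hS', mul_one]

theorem ι_val_mem_lipschitzGroup {a : V} {x : (CliffordAlgebra Q)ˣ}
    (hx : (x : CliffordAlgebra Q) = ι Q a) : x ∈ lipschitzGroup Q :=
  Subgroup.subset_closure ⟨a, hx.symm⟩

theorem ι_mem_pinGroup {a : V} (ha : Q a = -1) : ι Q a ∈ pinGroup Q := by
  have h1 : ι Q a * (-ι Q a) = 1 := by rw [mul_neg, ι_sq_scalar, ha, map_neg, map_one, neg_neg]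
  have h2 : -ι Q a * ι Q a = 1 := by rw [neg_mul, ι_sq_scalar, ha, map_neg, map_one, neg_neg]
  refine ⟨⟨⟨ι Q a, -ι Q a, h1, h2⟩, ι_val_mem_lipschitzGroup rfl, rfl⟩, ?_, ?_⟩
  · rwa [star_ι]
  · rwa [star_ι]

end General

variable {n : ℕ}

theorem minkowskiForm_apply (v : Fin (n + 1) → ℝ) :
    minkowskiForm n v = -(v 0 * v 0) + ∑ i : Fin n, v i.succ * v i.succ := by
  simp [minkowskiForm, QuadraticMap.weightedSumSquares_apply, Fin.sum_univ_succ]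

theorem euclideanForm_apply (w : Fin n → ℝ) : euclideanForm n w = ∑ i, w i * w i := by
  simp [euclideanForm, QuadraticMap.weightedSumSquares_apply]

theorem minkowskiForm_polar (v w : Fin (n + 1) → ℝ) :
    QuadraticMap.polar (minkowskiForm n) v w =
      2 * (-(v 0 * w 0) + ∑ i : Fin n, v i.succ * w i.succ) := by
  simp only [QuadraticMap.polar, minkowskiForm_apply, Pi.add_apply, mul_add, add_mul,
    Finset.sum_add_distrib, mul_comm (w (Fin.succ _)) (v (Fin.succ _))]
  ring

theorem minkowskiForm_nondegenerate :
    (QuadraticMap.polarBilin (minkowskiForm n)).Nondegenerate := by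
  have h : ∀ v, (∀ w, QuadraticMap.polar (minkowskiForm n) v w = 0) → v = 0 := by
    intro v hv
    ext i
    have := hv (Pi.single i 1)
    rw [minkowskiForm_polar] at this
    revert this
    refine Fin.cases ?_ (fun j => ?_) i
    · simp
    · intro h
      simpa [Pi.single_apply, Fin.succ_inj] using h
  refine ⟨fun v hv => h v hv, fun v hv => h v fun w => ?_⟩
  rw [QuadraticMap.polar_comm]
  exact hv w

/-- The unit vector in the time direction. -/
def timeAxis (n : ℕ) : Fin (n + 1) → ℝ := Pi.single 0 1

theorem minkowskiForm_timeAxis : minkowskiForm n (timeAxis n) = -1 := by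
  simp [minkowskiForm_apply, timeAxis]

/-! ### The Lorentz spin group preserves the future -/

/-- The reflection of a timelike vector `v` in `a` has the time component
`v₀ - polar a v * a₀ / Q a`; its product with `v₀` has the sign of `Q a`. -/
theorem reflection_time_sign {a v : Fin (n + 1) → ℝ} (ha : minkowskiForm n a ≠ 0)
    (hv : minkowskiForm n v < 0) :
    0 < minkowskiForm n a * (v 0 * v 0) - QuadraticMap.polar (minkowskiForm n) a v * a 0 * v 0 := by
  have key : minkowskiForm n a * (v 0 * v 0) - QuadraticMap.polar (minkowskiForm n) a v * a 0 * v 0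
      = ∑ i : Fin n, (v 0 * a i.succ - a 0 * v i.succ) ^ 2 + a 0 ^ 2 * (-minkowskiForm n v) := by
    have : ∀ i : Fin n, (v 0 * a i.succ - a 0 * v i.succ) ^ 2 =
        v 0 * v 0 * (a i.succ * a i.succ) - 2 * a 0 * v 0 * (a i.succ * v i.succ) +
          a 0 ^ 2 * (v i.succ * v i.succ) := fun i => by ring
    simp only [this, Finset.sum_add_distrib, Finset.sum_sub_distrib, ← Finset.mul_sum]
    rw [minkowskiForm_polar, minkowskiForm_apply, minkowskiForm_apply]
    ring
  have hs : 0 ≤ ∑ i : Fin n, (v 0 * a i.succ - a 0 * v i.succ) ^ 2 :=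
    Finset.sum_nonneg fun i _ => sq_nonneg _
  rw [key]
  by_cases h0 : a 0 = 0
  · have hv0 : 0 < v 0 * v 0 := by
      rw [minkowskiForm_apply] at hv
      have : 0 ≤ ∑ i : Fin n, v i.succ * v i.succ :=
        Finset.sum_nonneg fun i _ => mul_self_nonneg _
      linarith
    have ha' : 0 < minkowskiForm n a := by
      rw [minkowskiForm_apply, h0] at ha ⊢
      have : 0 ≤ ∑ i : Fin n, a i.succ * a i.succ :=
        Finset.sum_nonneg fun i _ => mul_self_nonneg _
      exact lt_of_le_of_ne (by simpa using this) ha.symm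
    rw [← key, h0]
    simpa using mul_pos ha' hv0
  · have := mul_pos (pow_pos (abs_pos.2 h0) 2) (neg_pos.2 hv)
    rw [sq_abs] at this
    linarith

/-- `y` has spinor norm `star y * y = c`, and conjugation by `y` maps timelike vectors to timelike
vectors, preserving the future or exchanging it with the past according to the sign of `c`. -/
def HasTimeSign (y : CliffordAlgebra (minkowskiForm n)) (c : ℝ) : Prop :=
  star y * y = algebraMap ℝ _ c ∧ ∀ v, minkowskiForm n v < 0 → ∃ w, minkowskiForm n w < 0 ∧
    0 < c * (v 0 * w 0) ∧ y * ι _ v = ι _ w * y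

theorem minkowskiForm_ne_zero_of_units {a : Fin (n + 1) → ℝ}
    {x : (CliffordAlgebra (minkowskiForm n))ˣ} (ha : ι _ a = (x : CliffordAlgebra (minkowskiForm n))) :
    minkowskiForm n a ≠ 0 :=
  (isUnit_of_isUnit_ι _ (ha ▸ x.isUnit : IsUnit (ι (minkowskiForm n) a))).ne_zero

theorem hasTimeSign_ι {a : Fin (n + 1) → ℝ} (ha : minkowskiForm n a ≠ 0) :
    HasTimeSign (ι _ a) (-minkowskiForm n a) := by
  refine ⟨by rw [star_ι, neg_mul, ι_sq_scalar, map_neg], fun v hv => ?_⟩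
  have hsign := reflection_time_sign ha hv
  have hswap := ι_mul_ι_add_swap (Q := minkowskiForm n) a v
  set q := minkowskiForm n a with hq
  set p := QuadraticMap.polar (minkowskiForm n) a v with hp
  -- The conjugate `a * v * a⁻¹` is minus the reflection of `v` in `a`.
  refine ⟨(p / q) • a - v, ?_, ?_, ?_⟩
  · have : minkowskiForm n ((p / q) • a - v) = minkowskiForm n v := by
      have h1 : QuadraticMap.polar (minkowskiForm n) ((p / q) • a) (-v) = -(p / q * p) := by
        rw [QuadraticMap.polar_neg_right, QuadraticMap.polar_smul_left, ← hp, smul_eq_mul]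
      rw [QuadraticMap.polar, ← sub_eq_add_neg, QuadraticMap.map_neg, QuadraticMap.map_smul, ← hq,
        smul_eq_mul] at h1
      have h2 : p / q * (p / q) * q = p / q * p := by field_simp
      linarith
    rwa [this]
  · have : -q * (v 0 * ((p / q) • a - v) 0) = q * (v 0 * v 0) - p * a 0 * v 0 := by
      simp only [Pi.sub_apply, Pi.smul_apply, smul_eq_mul]
      field_simp
      ring
    rwa [this]
  · have h3 : (p / q) • algebraMap ℝ (CliffordAlgebra (minkowskiForm n)) q = algebraMap ℝ _ p := by
      rw [← algebraMap.coe_smul, smul_eq_mul, div_mul_cancel₀ _ ha]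
    rw [map_sub, map_smul, sub_mul, smul_mul_assoc, ι_sq_scalar, ← hq, h3, ← hswap,
      add_sub_cancel_right]

theorem HasTimeSign.mul {x y : CliffordAlgebra (minkowskiForm n)} {c d : ℝ}
    (hx : HasTimeSign x c) (hy : HasTimeSign y d) : HasTimeSign (x * y) (c * d) := by
  obtain ⟨hc, hx⟩ := hx
  obtain ⟨hd, hy⟩ := hy
  refine ⟨?_, fun v hv => ?_⟩
  · rw [star_mul, mul_assoc, ← mul_assoc (star x), hc, Algebra.commutes, ← mul_assoc, hd,
      ← map_mul, mul_comm]
  · obtain ⟨w, hw, hvw, h1⟩ := hy v hv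
    obtain ⟨z, hz, hwz, h2⟩ := hx w hw
    refine ⟨z, hz, ?_, by rw [mul_assoc, h1, ← mul_assoc, h2, mul_assoc]⟩
    by_contra! h
    nlinarith [mul_pos hvw hwz, mul_nonneg (sub_nonneg.2 h) (sq_nonneg (w 0))]

/-- As the spinor norm is multiplicative, it is enough to look at vectors, whose spinor norm is
`-Q a`. -/
theorem exists_hasTimeSign {x : (CliffordAlgebra (minkowskiForm n))ˣ}
    (hx : x ∈ lipschitzGroup (minkowskiForm n)) :
    ∃ c, HasTimeSign (x : CliffordAlgebra (minkowskiForm n)) c := by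
  unfold lipschitzGroup at hx
  induction hx using Subgroup.closure_induction'' with
  | mem x hx =>
    obtain ⟨a, ha⟩ := hx
    exact ⟨_, ha ▸ hasTimeSign_ι (minkowskiForm_ne_zero_of_units ha)⟩
  | inv_mem x hx =>
    obtain ⟨a, ha⟩ := hx
    have hq := minkowskiForm_ne_zero_of_units ha
    have hinv : ((x⁻¹ : (CliffordAlgebra (minkowskiForm n))ˣ) : CliffordAlgebra (minkowskiForm n)) =
        ι _ ((minkowskiForm n a)⁻¹ • a) := by
      refine Units.inv_eq_of_mul_eq_one_right ?_
      rw [← ha, map_smul, mul_smul_comm, ι_sq_scalar, ← algebraMap.coe_smul, smul_eq_mul,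
        inv_mul_cancel₀ hq]
      exact map_one (algebraMap ℝ _)
    exact ⟨_, hinv ▸ hasTimeSign_ι (minkowskiForm_ne_zero_of_units hinv.symm)⟩
  | one =>
    refine ⟨1, by simp, fun v hv => ⟨v, hv, ?_, by simp⟩⟩
    rw [minkowskiForm_apply] at hv
    have : 0 ≤ ∑ i : Fin n, v i.succ * v i.succ := Finset.sum_nonneg fun i _ => mul_self_nonneg _
    linarith
  | mul x y _ _ hx hy =>
    obtain ⟨c, hx⟩ := hx
    obtain ⟨d, hy⟩ := hy
    exact ⟨c * d, hx.mul hy⟩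

/-- The open cone of future timelike vectors. -/
def futureCone (n : ℕ) : Set (Fin (n + 1) → ℝ) := {v | minkowskiForm n v < 0 ∧ 0 < v 0}

theorem vectorRep_mem_futureCone (S : LorentzSpin n) {v : Fin (n + 1) → ℝ}
    (hv : v ∈ futureCone n) : vectorRep (minkowskiForm n) S v ∈ futureCone n := by
  obtain ⟨⟨⟨x, hx, hxS⟩, hstar, -⟩, -⟩ := S.2
  obtain ⟨c, hc, hw⟩ := exists_hasTimeSign hx
  obtain ⟨w, hw, hpos, hSv⟩ := hw v hv.1
  have hxS' : (x : CliffordAlgebra (minkowskiForm n)) = S := hxS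
  rw [hxS'] at hc hSv
  rw [hstar, ← map_one (algebraMap ℝ (CliffordAlgebra (minkowskiForm n)))] at hc
  rw [← cliffordAlgebra_algebraMap_injective hc, one_mul] at hpos
  rw [vectorRep_eq_iff.2 hSv]
  exact ⟨hw, pos_of_mul_pos_right hpos hv.2.le⟩

theorem timeAxis_mem_futureCone : timeAxis n ∈ futureCone n :=
  ⟨by rw [minkowskiForm_timeAxis]; norm_num, by simp [timeAxis]⟩

/-- The reversed Cauchy-Schwarz inequality, on which the convexity of the future cone rests. -/
theorem polar_neg_of_mem_futureCone {v w : Fin (n + 1) → ℝ} (hv : v ∈ futureCone n)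
    (hw : w ∈ futureCone n) : QuadraticMap.polar (minkowskiForm n) v w < 0 := by
  obtain ⟨hv, hv0⟩ := hv
  obtain ⟨hw, hw0⟩ := hw
  rw [minkowskiForm_apply] at hv hw
  rw [minkowskiForm_polar]
  have hcs := Finset.sum_mul_sq_le_sq_mul_sq Finset.univ (fun i : Fin n => v i.succ)
    (fun i => w i.succ)
  simp only [sq (_ : ℝ)] at hcs
  have h1 : 0 ≤ ∑ i : Fin n, v i.succ * v i.succ := Finset.sum_nonneg fun i _ => mul_self_nonneg _
  have h2 : 0 ≤ ∑ i : Fin n, w i.succ * w i.succ := Finset.sum_nonneg fun i _ => mul_self_nonneg _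
  have h3 : (∑ i : Fin n, v i.succ * w i.succ) * (∑ i : Fin n, v i.succ * w i.succ) <
      (v 0 * w 0) * (v 0 * w 0) :=
    hcs.trans_lt ((mul_lt_mul'' ((neg_add_lt_iff_lt_add.1 hv).trans_eq (add_zero _))
      ((neg_add_lt_iff_lt_add.1 hw).trans_eq (add_zero _)) h1 h2).trans_eq (by ring))
  have := lt_of_mul_self_lt_mul_self₀ (mul_pos hv0 hw0).le h3
  linarith

theorem convex_futureCone : Convex ℝ (futureCone n) := by
  rw [convex_iff_forall_pos]
  intro v hv w hw a b ha hb _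
  refine ⟨?_, ?_⟩
  · have h1 : QuadraticMap.polar (minkowskiForm n) (a • v) (b • w) < 0 := by
      rw [QuadraticMap.polar_smul_left, QuadraticMap.polar_smul_right]
      exact mul_neg_of_pos_of_neg ha (mul_neg_of_pos_of_neg hb (polar_neg_of_mem_futureCone hv hw))
    rw [QuadraticMap.polar, QuadraticMap.map_smul, QuadraticMap.map_smul, smul_eq_mul,
      smul_eq_mul] at h1
    have h2 := mul_neg_of_pos_of_neg (mul_pos ha ha) hv.1
    have h3 := mul_neg_of_pos_of_neg (mul_pos hb hb) hw.1
    linarith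
  · exact add_pos (mul_pos ha hv.2) (mul_pos hb hw.2)

/-! ### Boosts -/

/-- For `u` a future unit vector, `e₀` the time axis and `N = -Q (e₀ + u) = 2 + 2 u₀`, the product of
the unit vectors `(e₀ + u) / √N` and `-e₀`: the spin lift of the boost that takes `e₀` to `u`. -/
def boostElement (u : Fin (n + 1) → ℝ) : CliffordAlgebra (minkowskiForm n) :=
  ι _ ((√(2 + 2 * u 0))⁻¹ • (timeAxis n + u)) * ι _ (-timeAxis n)

theorem boostElement_mem {u : Fin (n + 1) → ℝ} (hu : minkowskiForm n u = -1) (hu0 : 0 < u 0) :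
    boostElement u ∈ spinGroup (minkowskiForm n) := by
  refine ⟨mul_mem (ι_mem_pinGroup ?_) (ι_mem_pinGroup ?_), ι_mul_ι_mem_evenOdd_zero _ _ _⟩
  · have hN : 0 < 2 + 2 * u 0 := by linarith
    have h1 : minkowskiForm n (timeAxis n + u) = -(2 + 2 * u 0) := by
      have h2 : QuadraticMap.polar (minkowskiForm n) (timeAxis n) u = -2 * u 0 := by
        rw [minkowskiForm_polar]
        simp [timeAxis]
      rw [QuadraticMap.polar, minkowskiForm_timeAxis, hu] at h2
      linarith
    rw [QuadraticMap.map_smul, h1, smul_eq_mul, ← mul_inv, Real.mul_self_sqrt hN.le]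
    field_simp
  · rw [QuadraticMap.map_neg, minkowskiForm_timeAxis]

open Classical in
/-- The boost that takes the time axis to the future unit vector `u`, as an element of `Spin(n,1)`;
`1` if `u` is not a future unit vector. -/
def boost (u : Fin (n + 1) → ℝ) : LorentzSpin n :=
  if h : minkowskiForm n u = -1 ∧ 0 < u 0 then ⟨boostElement u, boostElement_mem h.1 h.2⟩ else 1

theorem coe_boost {u : Fin (n + 1) → ℝ} (hu : minkowskiForm n u = -1) (hu0 : 0 < u 0) :
    (boost u : CliffordAlgebra (minkowskiForm n)) = boostElement u := by
  rw [boost, dif_pos ⟨hu, hu0⟩]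

theorem vectorRep_boost {u : Fin (n + 1) → ℝ} (hu : minkowskiForm n u = -1) (hu0 : 0 < u 0) :
    vectorRep (minkowskiForm n) (boost u) (timeAxis n) = u := by
  rw [vectorRep_eq_iff, coe_boost hu hu0, boostElement]
  have h1 := ι_sq_scalar (minkowskiForm n) (timeAxis n)
  have h2 := ι_sq_scalar (minkowskiForm n) u
  rw [minkowskiForm_timeAxis, map_neg, map_one] at h1
  rw [hu, map_neg, map_one] at h2
  simp only [map_smul, map_add, map_neg, smul_mul_assoc, mul_smul_comm]
  congr 1
  rw [mul_assoc, neg_mul, h1, ← mul_assoc, mul_add, h2, mul_neg, mul_neg,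
    add_mul _ (-1), mul_assoc (ι (minkowskiForm n) u), mul_neg, h1]
  simp [add_comm]

/-! ### The stabilizer of the time axis -/

/-- The action of the vector `v = (v₀, w)` on `Cl(n) ⊕ e₀ Cl(n)`, written as pairs. -/
def cliffordSplitAux (n : ℕ) : (Fin (n + 1) → ℝ) →ₗ[ℝ]
    Module.End ℝ (CliffordAlgebra (euclideanForm n) × CliffordAlgebra (euclideanForm n)) where
  toFun v :=
    { toFun := fun x => (ι _ (Fin.tail v) * x.1 - v 0 • x.2, v 0 • x.1 - ι _ (Fin.tail v) * x.2)
      map_add' := fun x y => by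
        refine Prod.ext ?_ ?_ <;> simp only [Prod.fst_add, Prod.snd_add, mul_add, smul_add] <;> abel
      map_smul' := fun c x => by ext <;> simp [smul_sub, smul_comm c] }
  map_add' v w := by
    refine LinearMap.ext fun x => Prod.ext ?_ ?_ <;>
    simp only [LinearMap.coe_mk, AddHom.coe_mk, LinearMap.add_apply, Prod.fst_add, Prod.snd_add,
      show Fin.tail (v + w) = Fin.tail v + Fin.tail w from rfl, Pi.add_apply, map_add, add_mul,
      add_smul] <;> abel
  map_smul' c v := by
    refine LinearMap.ext fun x => Prod.ext ?_ ?_ <;>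
    simp [mul_smul, show Fin.tail (c • v) = c • Fin.tail v from rfl, smul_sub]

/-- The action of `Cl(n,1)` on `Cl(n) ⊕ e₀ Cl(n)` by left multiplication. -/
def cliffordSplit (n : ℕ) : CliffordAlgebra (minkowskiForm n) →ₐ[ℝ]
    Module.End ℝ (CliffordAlgebra (euclideanForm n) × CliffordAlgebra (euclideanForm n)) :=
  CliffordAlgebra.lift _ ⟨cliffordSplitAux n, fun v => by
    have hQ : minkowskiForm n v = -(v 0 * v 0) + euclideanForm n (Fin.tail v) := by
      rw [minkowskiForm_apply, euclideanForm_apply]; rfl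
    have hsq : ∀ x, ι (euclideanForm n) (Fin.tail v) * (ι _ (Fin.tail v) * x) =
        euclideanForm n (Fin.tail v) • x := fun x => by
      rw [← mul_assoc, ι_sq_scalar, Algebra.smul_def]
    refine LinearMap.ext fun x => Prod.ext ?_ ?_ <;>
    simp only [cliffordSplitAux, Module.End.mul_apply, LinearMap.coe_mk, AddHom.coe_mk, mul_sub,
      smul_sub, mul_smul_comm, smul_smul, hsq, Module.algebraMap_end_apply, hQ, Prod.smul_fst,
      Prod.smul_snd] <;> module⟩

/-- The linear projection of `Cl(n,1) = Cl(n) ⊕ e₀ Cl(n)` onto `Cl(n)`. -/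
def cliffordRetraction (n : ℕ) :
    CliffordAlgebra (minkowskiForm n) →ₗ[ℝ] CliffordAlgebra (euclideanForm n) :=
  LinearMap.fst ℝ _ _ ∘ₗ LinearMap.applyₗ (1, 0) ∘ₗ (cliffordSplit n).toLinearMap

theorem cliffordRetraction_map (y : CliffordAlgebra (euclideanForm n)) :
    cliffordRetraction n (CliffordAlgebra.map (spatialInclusion n) y) = y := by
  have : cliffordSplit n (CliffordAlgebra.map (spatialInclusion n) y) (1, 0) = (y, 0) := by
    induction y using CliffordAlgebra.left_induction with
    | algebraMap r =>
      rw [AlgHom.commutes, AlgHom.commutes, Module.algebraMap_end_apply]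
      ext <;> simp [Algebra.algebraMap_eq_smul_one]
    | add x y hx hy => rw [map_add, map_add, LinearMap.add_apply, hx, hy]; simp
    | ι_mul x w hx =>
      rw [map_mul, map_mul, Module.End.mul_apply, hx, CliffordAlgebra.map_apply_ι, cliffordSplit,
        CliffordAlgebra.lift_ι_apply]
      have h0 : spatialInclusion n w 0 = 0 := rfl
      have h1 : Fin.tail (spatialInclusion n w) = w := rfl
      ext <;> simp [cliffordSplitAux, h0, h1]
  simp [cliffordRetraction, this]

/-- The orthogonal projection onto space is not an isometry, so functoriality of Clifford algebras
does not provide a left inverse; the linear projection onto `Cl(n)` does. -/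
theorem cliffordMap_injective :
    Function.Injective (CliffordAlgebra.map (spatialInclusion n)) :=
  Function.LeftInverse.injective cliffordRetraction_map

theorem cliffordMap_involute (y : CliffordAlgebra (euclideanForm n)) :
    CliffordAlgebra.map (spatialInclusion n) (involute y) =
      involute (CliffordAlgebra.map (spatialInclusion n) y) := by
  induction y using CliffordAlgebra.induction with
  | algebraMap r => simp only [AlgHom.commutes]
  | ι v => simp
  | mul a b ha hb => simp only [map_mul, ha, hb]
  | add a b ha hb => simp only [map_add, ha, hb]

theorem cliffordMap_star (y : CliffordAlgebra (euclideanForm n)) :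
    CliffordAlgebra.map (spatialInclusion n) (star y) =
      star (CliffordAlgebra.map (spatialInclusion n) y) := by
  induction y using CliffordAlgebra.induction with
  | algebraMap r => simp only [AlgHom.commutes, star_algebraMap]
  | ι v => simp
  | mul a b ha hb => simp only [map_mul, star_mul, ha, hb]
  | add a b ha hb => simp only [map_add, star_add, ha, hb]

/-- The time axis is orthogonal to space. -/
theorem involute_cliffordMap_mul_ι_timeAxis (y : CliffordAlgebra (euclideanForm n)) :
    involute (CliffordAlgebra.map (spatialInclusion n) y) * ι _ (timeAxis n) =
      ι _ (timeAxis n) * CliffordAlgebra.map (spatialInclusion n) y := by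
  induction y using CliffordAlgebra.induction with
  | algebraMap r => simp only [AlgHom.commutes, Algebra.commutes]
  | ι v =>
    have h : QuadraticMap.polar (minkowskiForm n) (timeAxis n) (spatialInclusion n v) = 0 := by
      have : spatialInclusion n v 0 = 0 := rfl
      rw [minkowskiForm_polar]
      simp [timeAxis, this]
    rw [CliffordAlgebra.map_apply_ι, involute_ι, neg_mul, neg_eq_iff_add_eq_zero]
    exact (add_comm _ _).trans ((ι_mul_ι_add_swap _ _).trans (by rw [h, map_zero]))
  | mul a b ha hb => rw [map_mul, map_mul, mul_assoc, hb, ← mul_assoc, ha, mul_assoc]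
  | add a b ha hb => rw [map_add, map_add, add_mul, ha, hb, mul_add]

theorem euclideanForm_polar (v w : EuclideanSpace ℝ (Fin n)) :
    QuadraticMap.polar (euclideanForm n) v.ofLp w.ofLp = 2 * inner ℝ v w := by
  simp only [QuadraticMap.polar, euclideanForm_apply, Pi.add_apply, mul_add, add_mul,
    Finset.sum_add_distrib, PiLp.inner_apply, RCLike.inner_apply, conj_trivial]
  simp only [mul_comm]
  ring

theorem euclideanForm_ofLp (v : EuclideanSpace ℝ (Fin n)) : euclideanForm n v.ofLp = ‖v‖ ^ 2 := by
  rw [euclideanForm_apply, EuclideanSpace.norm_sq_eq]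
  simp [sq]

open LinearIsometryEquiv in
/-- Cartan-Dieudonné for the spin group: every isometry of Euclidean space is the twisted
conjugation by a product of unit vectors; such a product has spinor norm `1` if it is even, and `-1`
if it is odd. -/
theorem exists_lipschitz_lift
    (φ : EuclideanSpace ℝ (Fin n) ≃ₗᵢ[ℝ] EuclideanSpace ℝ (Fin n)) :
    ∃ g ∈ lipschitzGroup (euclideanForm n),
      (g.val ∈ evenOdd (euclideanForm n) 0 ∧ star g.val * g.val = 1 ∨
        g.val ∈ evenOdd (euclideanForm n) 1 ∧ star g.val * g.val = -1) ∧
      ∀ v, involute g.val * ι _ v.ofLp = ι _ (φ v).ofLp * g.val := by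
  obtain ⟨l, -, rfl⟩ := reflections_generate_dim φ
  induction l with
  | nil =>
    refine ⟨1, one_mem _, Or.inl ⟨?_, by simp⟩, fun v => by simp⟩
    exact Submodule.one_le.1 (one_le_evenOdd_zero _)
  | cons u l ih =>
    obtain ⟨g, hg, hpar, hφ⟩ := ih
    set φ := (l.map fun v => (ℝ ∙ v)ᗮ.reflection).prod with hφdef
    rw [List.map_cons, List.prod_cons, ← hφdef]
    by_cases hu : u = 0
    · refine ⟨g, hg, hpar, fun v => ?_⟩
      rw [hφ, LinearIsometryEquiv.coe_mul, Function.comp_apply]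
      subst hu
      rw [Submodule.reflection_orthogonal_apply, Submodule.reflection_singleton_apply]
      simp
    · obtain ⟨w, hw⟩ : ∃ w : EuclideanSpace ℝ (Fin n), w = ‖u‖⁻¹ • u := ⟨_, rfl⟩
      have hu' : ‖u‖ ≠ 0 := norm_ne_zero_iff.2 hu
      have hw1 : euclideanForm n w.ofLp = 1 := by
        rw [euclideanForm_ofLp, hw, norm_smul, norm_inv, norm_norm, inv_mul_cancel₀ hu', one_pow]
      have hsq : ι (euclideanForm n) w.ofLp * ι _ w.ofLp = 1 := by rw [ι_sq_scalar, hw1, map_one]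
      have hrefl : ∀ y, (ℝ ∙ u)ᗮ.reflection y = y - (2 * inner ℝ w y) • w := by
        intro y
        rw [Submodule.reflection_orthogonal_apply, Submodule.reflection_singleton_apply, neg_sub,
          hw, real_inner_smul_left, RCLike.ofReal_real_eq_id, id, two_smul, ← add_smul, smul_smul]
        congr 2
        field_simp
        ring
      have hconj : ∀ y : EuclideanSpace ℝ (Fin n), -(ι (euclideanForm n) w.ofLp * ι _ y.ofLp) =
          ι _ ((ℝ ∙ u)ᗮ.reflection y).ofLp * ι _ w.ofLp := by
        intro y
        have := ι_mul_ι_add_swap (Q := euclideanForm n) w.ofLp y.ofLp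
        rw [euclideanForm_polar] at this
        rw [hrefl, WithLp.ofLp_sub, WithLp.ofLp_smul, _root_.map_sub, _root_.map_smul, sub_mul,
          smul_mul_assoc, hsq, ← Algebra.algebraMap_eq_smul_one, ← this]
        abel
      let W : (CliffordAlgebra (euclideanForm n))ˣ := ⟨ι _ w.ofLp, ι _ w.ofLp, hsq, hsq⟩
      have hW : W ∈ lipschitzGroup (euclideanForm n) := ι_val_mem_lipschitzGroup rfl
      have hWg : (W * g).val = ι _ w.ofLp * g.val := rfl
      have hstar : star (W * g).val * (W * g).val = -(star g.val * g.val) := by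
        rw [hWg, star_mul, star_ι, mul_assoc, neg_mul, mul_neg, ← mul_assoc (ι _ w.ofLp), hsq,
          one_mul]
      refine ⟨W * g, mul_mem hW hg, ?_, fun v => ?_⟩
      · rw [hstar, hWg]
        rcases hpar with ⟨h1, h2⟩ | ⟨h1, h2⟩
        · exact Or.inr ⟨evenOdd_mul_le _ 1 0 (Submodule.mul_mem_mul (ι_mem_evenOdd_one _ _) h1), by
            rw [h2]⟩
        · exact Or.inl ⟨evenOdd_mul_le _ 1 1 (Submodule.mul_mem_mul (ι_mem_evenOdd_one _ _) h1), by
            rw [h2, neg_neg]⟩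
      · rw [hWg, map_mul, involute_ι, mul_assoc, hφ, ← mul_assoc, neg_mul, hconj, mul_assoc]
        rfl

theorem vectorRep_preserves_polar {V : Type*} [AddCommGroup V] [Module ℝ V] {Q : QuadraticForm ℝ V}
    (S : spinGroup Q) (v w : V) :
    QuadraticMap.polar Q (vectorRep Q S v) (vectorRep Q S w) = QuadraticMap.polar Q v w := by
  simp only [QuadraticMap.polar, ← map_add, vectorRep_preserves_form]

theorem polar_timeAxis (v : Fin (n + 1) → ℝ) :
    QuadraticMap.polar (minkowskiForm n) (timeAxis n) v = -2 * v 0 := by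
  rw [minkowskiForm_polar]
  simp [timeAxis]

/-- An element of `Spin(n,1)` that fixes the time axis restricts to an isometry of space. -/
theorem exists_spatial_isometry {S : LorentzSpin n}
    (hS : vectorRep (minkowskiForm n) S (timeAxis n) = timeAxis n) :
    ∃ φ : EuclideanSpace ℝ (Fin n) ≃ₗᵢ[ℝ] EuclideanSpace ℝ (Fin n), ∀ v,
      vectorRep (minkowskiForm n) S (spatialInclusion n v.ofLp) =
        spatialInclusion n (φ v).ofLp := by
  let T : EuclideanSpace ℝ (Fin n) →ₗ[ℝ] EuclideanSpace ℝ (Fin n) :=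
    { toFun := fun v => WithLp.toLp 2
        (Fin.tail (vectorRep (minkowskiForm n) S (spatialInclusion n v.ofLp)))
      map_add' := fun v w => by
        rw [WithLp.ofLp_add, map_add, map_add]; rfl
      map_smul' := fun c v => by
        rw [WithLp.ofLp_smul, map_smul, map_smul]; rfl }
  have hT : ∀ v, vectorRep (minkowskiForm n) S (spatialInclusion n v.ofLp) =
      spatialInclusion n (T v).ofLp := by
    intro v
    have h := vectorRep_preserves_polar S (timeAxis n) (spatialInclusion n v.ofLp)
    rw [hS, polar_timeAxis, polar_timeAxis, show spatialInclusion n v.ofLp 0 = 0 from rfl,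
      mul_zero] at h
    have h0 : vectorRep (minkowskiForm n) S (spatialInclusion n v.ofLp) 0 = 0 := by linarith
    refine (Fin.cons_self_tail _).symm.trans ?_
    rw [h0]
    rfl
  have hnorm : ∀ v, ‖T v‖ = ‖v‖ := by
    intro v
    refine (pow_left_inj₀ (norm_nonneg _) (norm_nonneg _) two_ne_zero).1 ?_
    rw [← euclideanForm_ofLp, ← euclideanForm_ofLp, ← (spatialInclusion n).map_app,
      ← (spatialInclusion n).map_app, ← hT, vectorRep_preserves_form]
  exact ⟨LinearIsometry.toLinearIsometryEquiv ⟨T, hnorm⟩ rfl, fun v => hT v⟩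

theorem neg_one_mem_lipschitzGroup (hn : 0 < n) : -1 ∈ lipschitzGroup (euclideanForm n) := by
  set w : Fin n → ℝ := Pi.single ⟨0, hn⟩ 1
  have hw : euclideanForm n w = 1 := by
    rw [euclideanForm_apply, Finset.sum_eq_single ⟨0, hn⟩] <;> simp +contextual [w]
  have hsq : ι (euclideanForm n) w * ι _ w = 1 := by rw [ι_sq_scalar, hw, map_one]
  let W : (CliffordAlgebra (euclideanForm n))ˣ := ⟨ι _ w, ι _ w, hsq, hsq⟩
  have hW : W ∈ lipschitzGroup (euclideanForm n) := ι_val_mem_lipschitzGroup rfl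
  have hW' : -W ∈ lipschitzGroup (euclideanForm n) :=
    ι_val_mem_lipschitzGroup (a := -w) (by rw [map_neg]; rfl)
  have : W * -W = -1 := by
    ext
    simpa [W] using hsq
  exact this ▸ mul_mem hW hW'

/-- The stabilizer of the time axis in `Spin(n,1)` is `Spin(n)`: if `S` fixes the time axis and `g`
is a product of spatial unit vectors that acts on space as `S` does, `g⁻¹ S` is a scalar. -/
theorem mem_range_spinInclusion (hn : 0 < n) {S : LorentzSpin n}
    (hS : vectorRep (minkowskiForm n) S (timeAxis n) = timeAxis n) :
    S ∈ (spinInclusion n).range := by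
  obtain ⟨φ, hφ⟩ := exists_spatial_isometry hS
  obtain ⟨g, hg, hpar, hgφ⟩ := exists_lipschitz_lift φ
  let y : (CliffordAlgebra (minkowskiForm n))ˣ :=
    Units.map (CliffordAlgebra.map (spatialInclusion n) : _ →* _) g
  have hy : y.val = CliffordAlgebra.map (spatialInclusion n) g.val := rfl
  have hSv : ∀ v, ∃ v', S.1 * ι _ v = ι _ v' * S.1 ∧ involute y.val * ι _ v = ι _ v' * y.val := by
    intro v
    let x : EuclideanSpace ℝ (Fin n) := WithLp.toLp 2 (Fin.tail v)
    have hv : v = v 0 • timeAxis n + spatialInclusion n x.ofLp := by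
      ext i
      refine Fin.cases ?_ (fun j => ?_) i
      · have : spatialInclusion n x.ofLp 0 = 0 := rfl
        simp [timeAxis, this]
      · have : spatialInclusion n x.ofLp j.succ = v j.succ := rfl
        simp [timeAxis, this]
    refine ⟨v 0 • timeAxis n + spatialInclusion n (φ x).ofLp, ?_, ?_⟩
    · rw [← vectorRep_eq_iff]
      conv_lhs => rw [hv]
      rw [map_add, map_smul, hS, hφ]
    · have h1 := congrArg (CliffordAlgebra.map (spatialInclusion n)) (hgφ x)
      rw [map_mul, map_mul, cliffordMap_involute, CliffordAlgebra.map_apply_ι,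
        CliffordAlgebra.map_apply_ι, ← hy] at h1
      conv_lhs => rw [hv]
      rw [map_add, map_smul, mul_add, mul_smul_comm, hy, involute_cliffordMap_mul_ι_timeAxis, ← hy,
        h1, map_add, map_smul, add_mul, smul_mul_assoc]
  have hinvol : involute S.1 = S.1 := spinGroup.involute_eq S.2
  have hcancel : involute y⁻¹.val * involute y.val = 1 := by
    rw [← map_mul, Units.inv_mul, map_one]
  obtain ⟨c, hc⟩ : ∃ c : ℝ, algebraMap ℝ _ c = y⁻¹.val * S.1 := by
    refine mem_range_algebraMap_of_involute_mul_ι minkowskiForm_nondegenerate fun v => ?_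
    obtain ⟨v', h1, h2⟩ := hSv v
    calc involute (y⁻¹.val * S.1) * ι _ v = involute y⁻¹.val * (S.1 * ι _ v) := by
          rw [map_mul, hinvol, mul_assoc]
      _ = involute y⁻¹.val * (ι _ v' * y.val) * (y⁻¹.val * S.1) := by
          rw [h1]; simp only [mul_assoc, Units.mul_inv_cancel_left]
      _ = ι _ v * (y⁻¹.val * S.1) := by
          rw [← h2, ← mul_assoc (involute y⁻¹.val), hcancel, one_mul]
  have hSc : S.1 = c • y.val := by
    rw [Algebra.smul_def, Algebra.commutes, hc, Units.mul_inv_cancel_left]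
  have hSS : star S.1 * S.1 = 1 := spinGroup.star_mul_self_of_mem S.2
  rcases hpar with ⟨heven, hstar⟩ | ⟨hodd, -⟩
  · have hcc : c * c = 1 := by
      rw [hSc, CliffordAlgebra.star_smul, smul_mul_smul_comm, hy, ← cliffordMap_star,
        ← map_mul, hstar, map_one, ← Algebra.algebraMap_eq_smul_one] at hSS
      exact cliffordAlgebra_algebraMap_injective (hSS.trans (map_one _).symm)
    obtain ⟨k, hk, hkS, hkeven, hkstar⟩ : ∃ k ∈ lipschitzGroup (euclideanForm n),
        S.1 = CliffordAlgebra.map (spatialInclusion n) k.val ∧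
          k.val ∈ evenOdd (euclideanForm n) 0 ∧ star k.val * k.val = 1 := by
      rcases mul_self_eq_one_iff.1 hcc with rfl | rfl
      · exact ⟨g, hg, by rw [hSc, one_smul, hy], heven, hstar⟩
      · refine ⟨-1 * g, mul_mem (neg_one_mem_lipschitzGroup hn) hg, ?_, ?_, ?_⟩
        · rw [hSc, hy]; simp
        · simpa using heven
        · simpa using hstar
    have hkstar' : k.val * star k.val = 1 := by
      rw [Units.eq_inv_of_mul_eq_one_right hkstar, Units.mul_inv]
    exact ⟨⟨k.val, ⟨⟨k, hk, rfl⟩, hkstar, hkstar'⟩, hkeven⟩, Subtype.ext hkS.symm⟩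
  -- An odd `g` is impossible, as `S` is even.
  · have h1 : involute S.1 = -S.1 := by
      rw [hSc, map_smul, hy, ← cliffordMap_involute, involute_eq_of_mem_odd hodd, map_neg, smul_neg]
    have h2 : (2 : ℝ) • S.1 = 0 := by
      rw [two_smul, add_eq_zero_iff_eq_neg]
      exact hinvol.symm.trans h1
    have h2 : S.1 = 0 := (smul_eq_zero.1 h2).resolve_left two_ne_zero
    rw [h2, mul_zero] at hSS
    exact absurd hSS zero_ne_one

theorem vectorRep_spinInclusion (S : EuclideanSpin n) :
    vectorRep (minkowskiForm n) (spinInclusion n S) (timeAxis n) = timeAxis n := by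
  rw [vectorRep_eq_iff]
  have := involute_cliffordMap_mul_ι_timeAxis (S : CliffordAlgebra (euclideanForm n))
  rwa [← cliffordMap_involute, spinGroup.involute_eq S.2] at this

end SpinGroups

/-! ### Topology and smoothness of spin-group-valued maps -/

section Smooth

variable {V : Type*} [AddCommGroup V] [Module ℝ V] {Q : QuadraticForm ℝ V}

instance cliffordAlgebra_isModuleTopology : IsModuleTopology ℝ (CliffordAlgebra Q) := ⟨rfl⟩

instance cliffordAlgebra_isTopologicalRing [Module.Finite ℝ V] :
    IsTopologicalRing (CliffordAlgebra Q) :=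
  IsModuleTopology.isTopologicalRing ℝ _

instance spinGroup_isTopologicalGroup [Module.Finite ℝ V] : IsTopologicalGroup (spinGroup Q) where
  continuous_mul := by
    refine continuous_induced_rng.2 ?_
    exact (continuous_subtype_val.comp continuous_fst).mul
      (continuous_subtype_val.comp continuous_snd)
  continuous_inv := by
    refine continuous_induced_rng.2 ?_
    let L : CliffordAlgebra Q →ₗ[ℝ] CliffordAlgebra Q :=
      { toFun := star, map_add' := star_add, map_smul' := CliffordAlgebra.star_smul }
    exact (IsModuleTopology.continuous_of_linearMap L).comp continuous_subtype_val

theorem spinInclusion_isEmbedding {n : ℕ} : Topology.IsEmbedding (spinInclusion n) := by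
  have hc : Continuous (spinInclusion n) := continuous_induced_rng.2 <|
    (IsModuleTopology.continuous_of_linearMap
      (CliffordAlgebra.map (spatialInclusion n)).toLinearMap).comp continuous_subtype_val
  have hr : Continuous fun S : LorentzSpin n =>
      cliffordRetraction n (S : CliffordAlgebra (minkowskiForm n)) :=
    (IsModuleTopology.continuous_of_linearMap _).comp continuous_subtype_val
  refine ⟨Topology.IsInducing.of_comp hc hr ?_, fun S T h => Subtype.ext ?_⟩
  · have : (fun S : LorentzSpin n => cliffordRetraction n (S : CliffordAlgebra (minkowskiForm n))) ∘
        spinInclusion n = Subtype.val := funext fun S => cliffordRetraction_map _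
    rw [this]
    exact Topology.IsInducing.subtypeVal
  · exact cliffordMap_injective (congrArg Subtype.val h)

variable {m : ℕ} {M : Type*} [TopologicalSpace M] [ChartedSpace (EuclideanSpace ℝ (Fin m)) M]

/-- Smoothness on a set of a map to a real vector space without a given topology: all compositions
with linear functionals are smooth. -/
def WeakSmoothOn (m : ℕ) {M : Type*} [TopologicalSpace M]
    [ChartedSpace (EuclideanSpace ℝ (Fin m)) M] {A : Type*} [AddCommGroup A] [Module ℝ A]
    (F : M → A) (U : Set M) : Prop :=
  ∀ φ : Module.Dual ℝ A, ContMDiffOn (𝓡 m) 𝓘(ℝ, ℝ) ∞ (fun x => φ (F x)) U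

section Weak

variable {A B C : Type*} [AddCommGroup A] [Module ℝ A] [AddCommGroup B] [Module ℝ B]
  [AddCommGroup C] [Module ℝ C] {U : Set M}

theorem WeakSmoothOn.linear {F : M → A} (hF : WeakSmoothOn m F U) (L : A →ₗ[ℝ] B) :
    WeakSmoothOn m (fun x => L (F x)) U :=
  fun φ => hF (φ ∘ₗ L)

theorem weakSmoothOn_const (a : A) : WeakSmoothOn m (fun _ : M => a) U :=
  fun _ => contMDiffOn_const

theorem WeakSmoothOn.bilinear [Module.Finite ℝ A] {F : M → A} {G : M → B}
    (hF : WeakSmoothOn m F U) (hG : WeakSmoothOn m G U) (L : A →ₗ[ℝ] B →ₗ[ℝ] C) :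
    WeakSmoothOn m (fun x => L (F x) (G x)) U := by
  intro φ
  let b := Module.finBasis ℝ A
  have h : ∀ x, φ (L (F x) (G x)) = ∑ i, b.coord i (F x) * φ (L (b i) (G x)) := by
    intro x
    conv_lhs => rw [← b.sum_repr (F x)]
    simp only [map_sum, map_smul, LinearMap.sum_apply, LinearMap.smul_apply, smul_eq_mul,
      Module.Basis.coord_apply]
  simp only [h]
  exact contMDiffOn_finsetSum fun i _ => (hF (b.coord i)).mul (hG (φ ∘ₗ L (b i)))

theorem ContMDiffOn.weakSmoothOn {k : ℕ} {F : M → Fin k → ℝ}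
    (hF : ContMDiffOn (𝓡 m) 𝓘(ℝ, Fin k → ℝ) ∞ F U) : WeakSmoothOn m F U :=
  fun φ => φ.toContinuousLinearMap.contMDiff.comp_contMDiffOn hF

theorem WeakSmoothOn.contMDiffOn {k : ℕ} {F : M → Fin k → ℝ} (hF : WeakSmoothOn m F U) :
    ContMDiffOn (𝓡 m) 𝓘(ℝ, Fin k → ℝ) ∞ F U :=
  contMDiffOn_pi_space.2 fun i => hF (LinearMap.proj i)

end Weak

variable {U : Set M}

theorem WeakSmoothOn.continuousOn [Module.Finite ℝ V] {F : M → CliffordAlgebra Q}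
    (hF : WeakSmoothOn m F U) : ContinuousOn F U := by
  let b := Module.finBasis ℝ (CliffordAlgebra Q)
  have h : F = fun x => ∑ i, b.coord i (F x) • b i := funext fun x => (b.sum_repr (F x)).symm
  rw [h]
  exact continuousOn_finsetSum _ fun i _ => (hF (b.coord i)).continuousOn.smul continuousOn_const

theorem SpinSmoothOn.weak {f : M → spinGroup Q} (hf : SpinSmoothOn (m := m) f U) :
    WeakSmoothOn m (fun x => (f x : CliffordAlgebra Q)) U := hf

theorem SpinSmoothOn.continuousOn [Module.Finite ℝ V] {f : M → spinGroup Q}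
    (hf : SpinSmoothOn (m := m) f U) : ContinuousOn f U :=
  Topology.IsInducing.subtypeVal.continuousOn_iff.2 hf.weak.continuousOn

theorem SpinSmoothOn.mono {f : M → spinGroup Q} {U' : Set M} (hf : SpinSmoothOn (m := m) f U)
    (h : U' ⊆ U) : SpinSmoothOn (m := m) f U' :=
  fun φ => (hf φ).mono h

theorem SpinSmoothOn.congr {f g : M → spinGroup Q} (hf : SpinSmoothOn (m := m) f U)
    (h : ∀ x ∈ U, g x = f x) : SpinSmoothOn (m := m) g U :=
  fun φ => (hf φ).congr fun x hx => by rw [h x hx]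

theorem spinSmoothOn_const (S : spinGroup Q) : SpinSmoothOn (m := m) (fun _ : M => S) U :=
  weakSmoothOn_const _

theorem SpinSmoothOn.mul [Module.Finite ℝ V] {f g : M → spinGroup Q}
    (hf : SpinSmoothOn (m := m) f U) (hg : SpinSmoothOn (m := m) g U) :
    SpinSmoothOn (m := m) (fun x => f x * g x) U :=
  hf.weak.bilinear hg.weak (LinearMap.mul ℝ (CliffordAlgebra Q))

theorem SpinSmoothOn.inv {f : M → spinGroup Q} (hf : SpinSmoothOn (m := m) f U) :
    SpinSmoothOn (m := m) (fun x => (f x)⁻¹) U := by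
  let L : CliffordAlgebra Q →ₗ[ℝ] CliffordAlgebra Q :=
    { toFun := star, map_add' := star_add, map_smul' := CliffordAlgebra.star_smul }
  exact hf.weak.linear L

theorem SpinSmoothOn.vectorRep [Module.Finite ℝ V] {f : M → spinGroup Q}
    (hf : SpinSmoothOn (m := m) f U) (v : V) :
    WeakSmoothOn m (fun x => vectorRep Q (f x) v) U := by
  have h := (hf.weak.bilinear (hf.inv.weak.linear
    (LinearMap.mulLeft ℝ (CliffordAlgebra.ι Q v))) (LinearMap.mul ℝ (CliffordAlgebra Q))).linear
      (cliffordToVector Q)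
  have heq : ∀ x, _root_.vectorRep Q (f x) v = cliffordToVector Q
      ((f x : CliffordAlgebra Q) * (CliffordAlgebra.ι Q v *
        (((f x)⁻¹ : spinGroup Q) : CliffordAlgebra Q))) := fun x => by
    rw [← mul_assoc, ← ι_vectorRep, cliffordToVector_ι]
  simp only [heq]
  exact h

/-- `Spin(n)` is embedded in `Spin(n,1)` as a submanifold. -/
theorem SpinSmoothOn.of_spinInclusion {n : ℕ} {f : M → EuclideanSpin n}
    (hf : SpinSmoothOn (m := m) (fun x => spinInclusion n (f x)) U) :
    SpinSmoothOn (m := m) f U := by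
  have h := hf.weak.linear (cliffordRetraction n)
  have heq : ∀ x, cliffordRetraction n (spinInclusion n (f x) : CliffordAlgebra (minkowskiForm n)) =
      (f x : CliffordAlgebra (euclideanForm n)) := fun x => cliffordRetraction_map _
  simp only [heq] at h
  exact h

theorem ContMDiffOn.spinSmoothOn_boost {n : ℕ} {u : M → Fin (n + 1) → ℝ}
    (hu : ContMDiffOn (𝓡 m) 𝓘(ℝ, Fin (n + 1) → ℝ) ∞ u U)
    (hu1 : ∀ x ∈ U, minkowskiForm n (u x) = -1 ∧ 0 < u x 0) :
    SpinSmoothOn (m := m) (fun x => boost (u x)) U := by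
  have h0 : ContMDiffOn (𝓡 m) 𝓘(ℝ, ℝ) ∞ (fun x => (√(2 + 2 * u x 0))⁻¹) U := by
    have h1 := contMDiffOn_pi_space.1 hu 0
    intro x hx
    have hpos : 0 < 2 + 2 * u x 0 := by linarith [(hu1 x hx).2]
    have h2 : ContDiffAt ℝ ∞ (fun t : ℝ => (√(2 + 2 * t))⁻¹) (u x 0) := by
      refine ContDiffAt.inv ?_ (Real.sqrt_ne_zero'.2 hpos)
      exact ContDiffAt.sqrt (by fun_prop) hpos.ne'
    exact ContMDiffAt.comp_contMDiffWithinAt (g := fun t : ℝ => (√(2 + 2 * t))⁻¹)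
      (f := fun x => u x 0) x h2.contMDiffAt (h1 x hx)
  have hw : ContMDiffOn (𝓡 m) 𝓘(ℝ, Fin (n + 1) → ℝ) ∞
      (fun x => (√(2 + 2 * u x 0))⁻¹ • (timeAxis n + u x)) U :=
    h0.smul (contMDiffOn_const.add hu)
  have := hw.weakSmoothOn.linear (LinearMap.mulRight ℝ
    (CliffordAlgebra.ι (minkowskiForm n) (-timeAxis n)) ∘ₗ CliffordAlgebra.ι (minkowskiForm n))
  intro φ
  refine (this φ).congr fun x hx => ?_
  rw [coe_boost (hu1 x hx).1 (hu1 x hx).2]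
  rfl

end Smooth

/-! ### Principal spin bundles and their local sections -/

namespace PrincipalSpinBundle

section General

variable {V : Type*} [AddCommGroup V] [Module ℝ V] {Q : QuadraticForm ℝ V} {m : ℕ} {M : Type u}
  [TopologicalSpace M] [ChartedSpace (EuclideanSpace ℝ (Fin m)) M]
  {P : PrincipalSpinBundle.{u, v} Q m M}
  {e e' : Bundle.Trivialization (spinGroup Q) P.proj}

/-- The local section `x ↦ e⁻¹ (x, 1)` of a principal bundle given by a local trivialization
`e`; only the values over the base set of `e` are meaningful. -/
def localSection (e : Bundle.Trivialization (spinGroup Q) P.proj) (x : M) : P.carrier :=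
  e.toOpenPartialHomeomorph.symm (x, 1)

theorem proj_localSection {x : M} (hx : x ∈ e.baseSet) : P.proj (localSection e x) = x :=
  e.proj_symm_apply' hx

theorem snd_localSection {x : M} (hx : x ∈ e.baseSet) : (e (localSection e x)).2 = 1 := by
  rw [localSection, e.apply_symm_apply' hx]

theorem ext_of_snd_eq {p q : P.carrier} (hp : P.proj p ∈ e.baseSet) (hpq : P.proj p = P.proj q)
    (h : (e p).2 = (e q).2) : p = q := by
  refine e.injOn (e.mem_source.2 hp) (e.mem_source.2 (hpq ▸ hp)) (Prod.ext ?_ h)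
  exact (e.coe_fst' hp).trans (hpq.trans (e.coe_fst' (hpq ▸ hp)).symm)

theorem localSection_act (he : e ∈ P.atlas) {x : M} (hx : x ∈ e.baseSet) (S : spinGroup Q) :
    localSection e x <• S = e.toOpenPartialHomeomorph.symm (x, S) := by
  have hp : P.proj (localSection e x <• S) = x := by rw [P.proj_act, proj_localSection hx]
  refine ext_of_snd_eq (e := e) (by rwa [hp]) (by rw [hp, e.proj_symm_apply' hx]) ?_
  rw [P.triv_act e he _ (by rwa [proj_localSection hx]), snd_localSection hx, one_mul,
    e.apply_symm_apply' hx]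

theorem eq_localSection_act (he : e ∈ P.atlas) {p : P.carrier} (hp : P.proj p ∈ e.baseSet) :
    p = localSection e (P.proj p) <• (e p).2 := by
  have h : P.proj (localSection e (P.proj p) <• (e p).2) = P.proj p := by
    rw [P.proj_act, proj_localSection hp]
  refine ext_of_snd_eq hp h.symm ?_
  rw [P.triv_act e he _ (by rwa [proj_localSection hp]), snd_localSection hp, one_mul]

theorem exists_act_eq {p q : P.carrier} (h : P.proj p = P.proj q) :
    ∃ S : spinGroup Q, q = p <• S := by
  obtain ⟨e, he, hx⟩ := P.exists_mem_baseSet (P.proj p)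
  refine ⟨((e p).2)⁻¹ * (e q).2, ext_of_snd_eq (e := e) (h ▸ hx) (by rw [P.proj_act, h]) ?_⟩
  rw [P.triv_act e he _ hx, mul_inv_cancel_left]

end General

section Lorentz

variable {n : ℕ} {m : ℕ} {M : Type u} [TopologicalSpace M]
  [ChartedSpace (EuclideanSpace ℝ (Fin m)) M]

/-! ### Unit time fields -/

/-- A smooth section of the bundle of hyperboloids associated with `P`, as an equivariant function
on the total space: its values are future unit vectors of Minkowski space. -/
structure UnitTimeField (P : PrincipalSpinBundle.{u, v} (minkowskiForm n) m M) where
  toFun : P.carrier → Fin (n + 1) → ℝ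
  form_eq : ∀ p, minkowskiForm n (toFun p) = -1
  future : ∀ p, 0 < toFun p 0
  equivariant : ∀ p S, vectorRep (minkowskiForm n) S (toFun (p <• S)) = toFun p
  smooth : ∀ e ∈ P.atlas, ContMDiffOn (𝓡 m) 𝓘(ℝ, Fin (n + 1) → ℝ) ∞
    (fun x => toFun (localSection e x)) e.baseSet

/-- The convex combination, by a partition of unity, of the fields that are the time axis in the
fibre coordinate of a trivialization. -/
theorem exists_future_field [IsManifold (𝓡 m) ∞ M] [T2Space M] [SecondCountableTopology M]
    (P : PrincipalSpinBundle.{u, v} (minkowskiForm n) m M) :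
    ∃ f : P.carrier → Fin (n + 1) → ℝ, (∀ p, f p ∈ futureCone n) ∧
      (∀ p S, vectorRep (minkowskiForm n) S (f (p <• S)) = f p) ∧
      ∀ e ∈ P.atlas, ContMDiffOn (𝓡 m) 𝓘(ℝ, Fin (n + 1) → ℝ) ∞
        (fun x => f (localSection e x)) e.baseSet := by
  have : LocallyCompactSpace M := ChartedSpace.locallyCompactSpace (EuclideanSpace ℝ (Fin m)) M
  choose E hE hxE using P.exists_mem_baseSet
  obtain ⟨ρ, hρ⟩ := SmoothPartitionOfUnity.exists_isSubordinate (𝓡 m) (s := (Set.univ : Set M))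
    isClosed_univ (fun x => (E x).baseSet) (fun x => (E x).open_baseSet)
    (fun x _ => Set.mem_iUnion.2 ⟨x, hxE x⟩)
  have hmem : ∀ i x, ρ i x ≠ 0 → x ∈ (E i).baseSet := fun i x h => hρ i (subset_tsupport _ h)
  refine ⟨fun p => ∑ᶠ i, ρ i (P.proj p) •
    vectorRep (minkowskiForm n) ((E i p).2)⁻¹ (timeAxis n), fun p => ?_, fun p S => ?_,
    fun e he => ?_⟩
  · exact ρ.finsum_smul_mem_convex (Set.mem_univ (P.proj p))
      (g := fun i _ => vectorRep (minkowskiForm n) ((E i p).2)⁻¹ (timeAxis n))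
      (fun i _ => vectorRep_mem_futureCone _ timeAxis_mem_futureCone) convex_futureCone
  · have hfin : (Function.support fun i => ρ i (P.proj p) •
        vectorRep (minkowskiForm n) ((E i (p <• S)).2)⁻¹ (timeAxis n)).Finite :=
      (ρ.locallyFinite.point_finite (P.proj p)).subset fun i hi => by
        intro h
        exact hi (by simp only [h, zero_smul])
    simp only [P.proj_act]
    refine ((vectorRep (minkowskiForm n) S).toAddMonoidHom.map_finsum hfin).trans ?_
    refine finsum_congr fun i => ?_
    rw [LinearMap.toAddMonoidHom_coe, map_smul]
    by_cases h : ρ i (P.proj p) = 0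
    · rw [h, zero_smul, zero_smul]
    · rw [P.triv_act _ (hE i) p (hmem i _ h), ← vectorRep_mul, mul_inv_rev, mul_inv_cancel_left]
  · intro x hx
    have hsmooth : ContMDiffAt (𝓡 m) 𝓘(ℝ, Fin (n + 1) → ℝ) ∞ (fun x => ∑ᶠ i, ρ i x •
        vectorRep (minkowskiForm n) ((E i (localSection e x)).2)⁻¹ (timeAxis n)) x := by
      refine ρ.contMDiffAt_finsum fun i hi => ?_
      have h1 := ((P.smooth_transition e he (E i) (hE i)).inv.vectorRep (timeAxis n)).contMDiffOn
      exact h1.contMDiffAt ((e.open_baseSet.inter (E i).open_baseSet).mem_nhds ⟨hx, hρ i hi⟩)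
    refine (hsmooth.contMDiffWithinAt (s := e.baseSet)).congr (fun y hy => ?_) ?_
    · simp only [proj_localSection hy]
    · simp only [proj_localSection hx]

theorem nonempty_unitTimeField [IsManifold (𝓡 m) ∞ M] [T2Space M] [SecondCountableTopology M]
    (P : PrincipalSpinBundle.{u, v} (minkowskiForm n) m M) : Nonempty (UnitTimeField P) := by
  obtain ⟨f, hf, hequiv, hsmooth⟩ := exists_future_field P
  have hpos : ∀ p, 0 < -minkowskiForm n (f p) := fun p => neg_pos.2 (hf p).1
  refine ⟨⟨fun p => (√(-minkowskiForm n (f p)))⁻¹ • f p, fun p => ?_, fun p => ?_, fun p S => ?_,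
    fun e he => ?_⟩⟩
  · rw [QuadraticMap.map_smul, smul_eq_mul, ← mul_inv, Real.mul_self_sqrt (hpos p).le]
    have := (hf p).1.ne
    field_simp
  · exact mul_pos (inv_pos.2 (Real.sqrt_pos.2 (hpos p))) (hf p).2
  · rw [map_smul, hequiv, ← vectorRep_preserves_form S (f (p <• S)), hequiv]
  · have h2 : ∀ v : Fin (n + 1) → ℝ, 0 < -minkowskiForm n v →
        ContDiffAt ℝ ∞ (fun v : Fin (n + 1) → ℝ => (√(-minkowskiForm n v))⁻¹) v := by
      intro v hv
      refine ContDiffAt.inv (ContDiffAt.sqrt ?_ hv.ne') (Real.sqrt_ne_zero'.2 hv)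
      simp only [minkowskiForm_apply]
      fun_prop
    have hr : ContMDiffOn (𝓡 m) 𝓘(ℝ, ℝ) ∞
        (fun x => (√(-minkowskiForm n (f (localSection e x))))⁻¹) e.baseSet := fun x hx =>
      ContMDiffAt.comp_contMDiffWithinAt
      (g := fun v : Fin (n + 1) → ℝ => (√(-minkowskiForm n v))⁻¹)
      (f := fun x => f (localSection e x)) x (h2 _ (hpos _)).contMDiffAt (hsmooth e he x hx)
    exact hr.smul (hsmooth e he)

namespace UnitTimeField

variable {P : PrincipalSpinBundle.{u, v} (minkowskiForm n) m M} (f : UnitTimeField P)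
  {e e' : Bundle.Trivialization (LorentzSpin n) P.proj}

theorem vectorRep_eq_of_act {p q : P.carrier} (hp : f.toFun p = timeAxis n)
    (hq : f.toFun q = timeAxis n) {S : LorentzSpin n} (h : q = p <• S) :
    vectorRep (minkowskiForm n) S (timeAxis n) = timeAxis n := by
  have := f.equivariant p S
  rwa [← h, hq, hp] at this

/-- The boost along `f` of a local section, so that the value of `f` becomes the time axis. -/
def adaptedSection (e : Bundle.Trivialization (LorentzSpin n) P.proj) (x : M) : P.carrier :=
  localSection e x <• boost (f.toFun (localSection e x))

theorem toFun_act_spinInclusion {p : P.carrier} (hp : f.toFun p = timeAxis n) (S : EuclideanSpin n) :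
    f.toFun (p <• spinInclusion n S) = timeAxis n := by
  have h := f.equivariant p (spinInclusion n S)
  rw [← vectorRep_inv_apply_eq_iff, ← map_inv, hp, vectorRep_spinInclusion] at h
  exact h.symm

theorem toFun_adaptedSection (x : M) : f.toFun (f.adaptedSection e x) = timeAxis n := by
  have h := f.equivariant (localSection e x) (boost (f.toFun (localSection e x)))
  rw [← vectorRep_inv_apply_eq_iff] at h
  rw [adaptedSection, ← h, vectorRep_inv_apply_eq_iff, vectorRep_boost (f.form_eq _) (f.future _)]

theorem proj_adaptedSection {x : M} (hx : x ∈ e.baseSet) : P.proj (f.adaptedSection e x) = x := by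
  rw [adaptedSection, P.proj_act, proj_localSection hx]

theorem spinSmoothOn_boost (he : e ∈ P.atlas) :
    SpinSmoothOn (m := m) (fun x => boost (f.toFun (localSection e x))) e.baseSet :=
  (f.smooth e he).spinSmoothOn_boost fun _ _ => ⟨f.form_eq _, f.future _⟩

theorem spinSmoothOn_adaptedSection (he : e ∈ P.atlas) (he' : e' ∈ P.atlas) :
    SpinSmoothOn (m := m) (fun x => (e' (f.adaptedSection e x)).2) (e.baseSet ∩ e'.baseSet) := by
  refine ((P.smooth_transition e he e' he').mul
    ((f.spinSmoothOn_boost he).mono Set.inter_subset_left)).congr fun x hx => ?_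
  rw [adaptedSection, P.triv_act e' he' _ (by rw [proj_localSection hx.1]; exact hx.2)]
  rfl

/-! ### The reduced bundle -/

/-- The total space of the reduced bundle: the points of `P` at which `f` takes the time axis as value. -/
abbrev ReducedSpace := {p : P.carrier // f.toFun p = timeAxis n}

instance : MulAction (EuclideanSpin n)ᵐᵒᵖ f.ReducedSpace where
  smul S p := ⟨p.1 <• spinInclusion n S.unop, f.toFun_act_spinInclusion p.2 _⟩
  one_smul p := Subtype.ext (by
    change p.1 <• spinInclusion n 1 = p.1
    rw [map_one, MulOpposite.op_one, one_smul])
  mul_smul S T p := Subtype.ext (by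
    change p.1 <• spinInclusion n (T.unop * S.unop) =
      (p.1 <• spinInclusion n T.unop) <• spinInclusion n S.unop
    rw [map_mul, MulOpposite.op_mul, mul_smul])

variable {f} in
/-- In a trivialization of `P`, the fibre coordinate of a point of the reduced bundle is the
product of the boost with an element of `Spin(n)`. -/
theorem boost_inv_mul_mem_range (hn : 0 < n) (he : e ∈ P.atlas) {p : P.carrier}
    (hp : f.toFun p = timeAxis n) (hx : P.proj p ∈ e.baseSet) :
    (boost (f.toFun (localSection e (P.proj p))))⁻¹ * (e p).2 ∈ (spinInclusion n).range := by
  refine mem_range_spinInclusion hn (f.vectorRep_eq_of_act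
    (f.toFun_adaptedSection (e := e) (P.proj p)) hp ?_)
  conv_lhs => rw [eq_localSection_act he hx]
  rw [adaptedSection, ← mul_smul, ← MulOpposite.op_mul, mul_inv_cancel_left]

/-- The inverse of the embedding `Spin(n) ↪ Spin(n,1)` on its image; arbitrary off it. -/
def spinRestriction (n : ℕ) : LorentzSpin n → EuclideanSpin n :=
  Function.invFun (spinInclusion n)

theorem spinInclusion_spinRestriction {S : LorentzSpin n} (hS : S ∈ (spinInclusion n).range) :
    spinInclusion n (spinRestriction n S) = S :=
  Function.invFun_eq hS

theorem spinRestriction_spinInclusion (S : EuclideanSpin n) :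
    spinRestriction n (spinInclusion n S) = S :=
  Function.leftInverse_invFun spinInclusion_isEmbedding.injective S

theorem adaptedSection_act (he : e ∈ P.atlas) {x : M} (hx : x ∈ e.baseSet) (S : LorentzSpin n) :
    f.adaptedSection e x <• S =
      e.toOpenPartialHomeomorph.symm (x, boost (f.toFun (localSection e x)) * S) := by
  rw [adaptedSection, ← mul_smul, ← MulOpposite.op_mul, localSection_act he hx]

theorem snd_adaptedSection_act (he : e ∈ P.atlas) {x : M} (hx : x ∈ e.baseSet) (S : LorentzSpin n) :
    (e (f.adaptedSection e x <• S)).2 = boost (f.toFun (localSection e x)) * S := by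
  rw [f.adaptedSection_act he hx, e.apply_symm_apply' hx]

/-- The local trivialization of the reduced bundle whose unit section is the adapted section. -/
def reducedTrivialization (hn : 0 < n) (e : Bundle.Trivialization (LorentzSpin n) P.proj)
    (he : e ∈ P.atlas) :
    Bundle.Trivialization (EuclideanSpin n) (fun p : f.ReducedSpace => P.proj p.1) where
  toFun p := (P.proj p.1, spinRestriction n
    ((boost (f.toFun (localSection e (P.proj p.1))))⁻¹ * (e p.1).2))
  invFun z := ⟨f.adaptedSection e z.1 <• spinInclusion n z.2,
    f.toFun_act_spinInclusion (f.toFun_adaptedSection z.1) z.2⟩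
  source := (fun p : f.ReducedSpace => P.proj p.1) ⁻¹' e.baseSet
  target := e.baseSet ×ˢ Set.univ
  baseSet := e.baseSet
  open_baseSet := e.open_baseSet
  source_eq := rfl
  target_eq := rfl
  proj_toFun _ _ := rfl
  map_source' p hp := ⟨hp, Set.mem_univ _⟩
  map_target' z hz := by
    change P.proj (f.adaptedSection e z.1 <• spinInclusion n z.2) ∈ e.baseSet
    rw [P.proj_act, f.proj_adaptedSection hz.1]
    exact hz.1
  left_inv' p hp := by
    refine Subtype.ext ?_
    change f.adaptedSection e (P.proj p.1) <• spinInclusion n (spinRestriction n _) = p.1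
    rw [spinInclusion_spinRestriction (boost_inv_mul_mem_range hn he p.2 hp), adaptedSection,
      ← mul_smul, ← MulOpposite.op_mul, mul_inv_cancel_left, ← eq_localSection_act he hp]
  right_inv' z hz := by
    have h : P.proj (f.adaptedSection e z.1 <• spinInclusion n z.2) = z.1 := by
      rw [P.proj_act, f.proj_adaptedSection hz.1]
    refine Prod.ext h ?_
    dsimp only
    rw [h, f.snd_adaptedSection_act he hz.1, inv_mul_cancel_left, spinRestriction_spinInclusion]
  open_source := by
    have : (fun p : f.ReducedSpace => P.proj p.1) ⁻¹' e.baseSet = Subtype.val ⁻¹' e.source := by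
      rw [e.source_eq]; rfl
    rw [this]
    exact e.open_source.preimage continuous_subtype_val
  open_target := e.open_baseSet.prod isOpen_univ
  continuousOn_toFun := by
    have hval : Set.MapsTo (Subtype.val : f.ReducedSpace → P.carrier)
        ((fun p : f.ReducedSpace => P.proj p.1) ⁻¹' e.baseSet) e.source :=
      fun p hp => e.mem_source.2 hp
    have hproj : ContinuousOn (fun p : f.ReducedSpace => P.proj p.1)
        ((fun p : f.ReducedSpace => P.proj p.1) ⁻¹' e.baseSet) :=
      e.continuousOn_proj.comp continuous_subtype_val.continuousOn hval
    have hsnd : ContinuousOn (fun p : f.ReducedSpace => (e p.1).2)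
        ((fun p : f.ReducedSpace => P.proj p.1) ⁻¹' e.baseSet) :=
      continuous_snd.comp_continuousOn
        (e.continuousOn_toFun.comp continuous_subtype_val.continuousOn hval)
    have hboost := (f.spinSmoothOn_boost he).continuousOn.comp hproj fun p hp => hp
    refine hproj.prodMk (spinInclusion_isEmbedding.isInducing.continuousOn_iff.2 ?_)
    exact (hboost.inv.mul hsnd).congr fun p hp =>
      spinInclusion_spinRestriction (boost_inv_mul_mem_range hn he p.2 hp)
  continuousOn_invFun := by
    refine Topology.IsInducing.subtypeVal.continuousOn_iff.2 ?_
    have hboost := (f.spinSmoothOn_boost he).continuousOn.comp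
      (continuous_fst (X := M) (Y := EuclideanSpin n)).continuousOn
      (fun z (hz : z ∈ e.baseSet ×ˢ (Set.univ : Set (EuclideanSpin n))) => hz.1)
    have hprod : ContinuousOn (fun z : M × EuclideanSpin n =>
        (z.1, boost (f.toFun (localSection e z.1)) * spinInclusion n z.2))
        (e.baseSet ×ˢ Set.univ) :=
      continuousOn_fst.prodMk (hboost.mul
        (spinInclusion_isEmbedding.continuous.comp continuous_snd).continuousOn)
    refine (e.toOpenPartialHomeomorph.continuousOn_symm.comp hprod
      fun z hz => e.mem_target.2 hz.1).congr
      fun z hz => f.adaptedSection_act he hz.1 _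

theorem coe_reducedTrivialization_symm (hn : 0 < n) (he : e ∈ P.atlas) (x : M) :
    (((f.reducedTrivialization hn e he).toOpenPartialHomeomorph.symm (x, 1) :
      f.ReducedSpace) : P.carrier) = f.adaptedSection e x := by
  change f.adaptedSection e x <• spinInclusion n 1 = _
  rw [map_one, MulOpposite.op_one, one_smul]

/-- The principal `Spin(n)`-bundle of the points of `P` at which `f` is the time axis. -/
def reducedBundle (hn : 0 < n) : PrincipalSpinBundle.{u, v} (euclideanForm n) m M where
  carrier := f.ReducedSpace
  proj p := P.proj p.1
  atlas := {t | ∃ e, ∃ he : e ∈ P.atlas, t = f.reducedTrivialization hn e he}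
  exists_mem_baseSet x := by
    obtain ⟨e, he, hx⟩ := P.exists_mem_baseSet x
    exact ⟨_, ⟨e, he, rfl⟩, hx⟩
  proj_act p S := P.proj_act p.1 _
  triv_act := by
    rintro _ ⟨e, he, rfl⟩ p hp S
    change spinRestriction n ((boost (f.toFun (localSection e (P.proj (p.1 <• spinInclusion n S)))))⁻¹
      * (e (p.1 <• spinInclusion n S)).2) = spinRestriction n
        ((boost (f.toFun (localSection e (P.proj p.1))))⁻¹ * (e p.1).2) * S
    refine spinInclusion_isEmbedding.injective ?_
    have hr := boost_inv_mul_mem_range hn he p.2 hp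
    rw [P.proj_act, P.triv_act e he p.1 hp, map_mul, spinInclusion_spinRestriction hr, ← mul_assoc,
      spinInclusion_spinRestriction (mul_mem hr ⟨S, rfl⟩)]
  smooth_transition := by
    rintro _ ⟨e, he, rfl⟩ _ ⟨e', he', rfl⟩
    refine SpinSmoothOn.of_spinInclusion ?_
    refine (((f.spinSmoothOn_boost he').inv.mono Set.inter_subset_right).mul
      (f.spinSmoothOn_adaptedSection he he')).congr fun x hx => ?_
    change spinInclusion n (spinRestriction n ((boost (f.toFun (localSection e' (P.proj
      ((f.reducedTrivialization hn e he).toOpenPartialHomeomorph.symm (x, 1)).1))))⁻¹ *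
      (e' ((f.reducedTrivialization hn e he).toOpenPartialHomeomorph.symm (x, 1)).1).2)) = _
    rw [coe_reducedTrivialization_symm, spinInclusion_spinRestriction
      (boost_inv_mul_mem_range hn he' (f.toFun_adaptedSection x) _), f.proj_adaptedSection hx.1]
    rw [f.proj_adaptedSection hx.1]
    exact hx.2

/-- The reduction of `P` to `Spin(n)` given by a unit time field. -/
def reduction (hn : 0 < n) : P.Reduction (spinInclusion n) where
  bundle := f.reducedBundle hn
  toFun p := p.1
  proj_toFun _ := rfl
  map_act _ _ := rfl
  smooth := by
    rintro _ ⟨e, he, rfl⟩ e' he'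
    refine (f.spinSmoothOn_adaptedSection he he').congr fun x _ => ?_
    exact congrArg (fun q => (e' q).2) (f.coe_reducedTrivialization_symm hn he x)
  isEmbedding := Topology.IsEmbedding.subtypeVal

/-- The section is `x ↦ [p, 1]` with `p` over `x` in the reduced bundle; the points over `x` differ by
`Spin(n)`, so the class does not depend on `p`, and locally `p` may be an adapted section. -/
theorem exists_isSmoothCosetSection (f : UnitTimeField P) (hn : 0 < n) :
    ∃ s : M → P.CosetBundle (spinInclusion n).range,
      P.IsSmoothCosetSection (spinInclusion n).range s := by
  have hex : ∀ x, ∃ p, P.proj p = x ∧ f.toFun p = timeAxis n := fun x => by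
    obtain ⟨e, -, hx⟩ := P.exists_mem_baseSet x
    exact ⟨f.adaptedSection e x, f.proj_adaptedSection hx, f.toFun_adaptedSection x⟩
  choose p hp hfp using hex
  refine ⟨fun x => Quotient.mk (P.cosetSetoid _) (p x, ((1 : LorentzSpin n) : _ ⧸ _)),
    fun x => hp x, fun x₀ => ?_⟩
  obtain ⟨e, he, hx₀⟩ := P.exists_mem_baseSet x₀
  refine ⟨e.baseSet, e.open_baseSet.mem_nhds hx₀, f.adaptedSection e, fun _ => 1,
    ⟨fun x hx => f.proj_adaptedSection hx, fun e' he' => f.spinSmoothOn_adaptedSection he he'⟩,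
    spinSmoothOn_const 1, fun x hx => Quotient.sound ?_⟩
  obtain ⟨S, hS⟩ := exists_act_eq ((hp x).trans (f.proj_adaptedSection hx).symm)
  have hmem := mem_range_spinInclusion hn
    (f.vectorRep_eq_of_act (hfp x) (f.toFun_adaptedSection x) hS)
  refine ⟨S, Prod.ext hS ?_⟩
  refine QuotientGroup.eq.2 ?_
  simpa using hmem

end UnitTimeField

end Lorentz

end PrincipalSpinBundle

end

theorem theorem1 (n : ℕ) (hn : 3 ≤ n) (M : Type u) [TopologicalSpace M]
    [T2Space M] [SecondCountableTopology M]
    [ChartedSpace (EuclideanSpace ℝ (Fin (n + 1))) M] [IsManifold (𝓡 (n + 1)) ∞ M]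
    (hM : IsLorentzSpinManifold n M)
    (P : PrincipalSpinBundle.{u, v} (minkowskiForm n) (n + 1) M) :
    Nonempty (P.Reduction (spinInclusion n)) ∧
      ∃ s : M → P.CosetBundle (spinInclusion n).range,
        P.IsSmoothCosetSection (spinInclusion n).range s := by
  obtain ⟨f⟩ := PrincipalSpinBundle.nonempty_unitTimeField P
  have hn' : 0 < n := by omega
  exact ⟨⟨f.reduction hn'⟩, f.exists_isSmoothCosetSection hn'⟩
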